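/- Setting. Let $0<\alpha<1$, $T>0$, let $\Omega\subset\mathbb{R}^d$ be open (in particular, any bounded Lipschitz domain with $d\in\{1,2,3\}$ is allowed), and let $\|\cdot\|$ and $\langle\cdot,\cdot\rangle$ be the norm and inner product (extended to the duality pairing) of $L_2(\Omega)$. Let $\mathcal L v=-\sum_{i,j}\partial_i(a_{ij}\partial_j v)-\sum_i\partial_i(p_i v)+\sum_i b_i\,\partial_i v+cv$ be a uniformly elliptic operator with coefficients in $L_\infty(\Omega)$ such that, for some $\lambda\in\mathbb{R}$, $\langle\mathcal L v,v\rangle\ge\lambda\|v\|^2$ for all $v\in H^1_0(\Omega)$. For a function $v$ of $t$ and $t>0$ the Caputo derivative is $$D_t^\alpha v(t)=\frac1{\Gamma(1-\alpha)}\int_0^t(t-s)^{-\alpha}\,\partial_sv(s)\,ds:=\frac1{\Gamma(1-\alpha)}\lim_{\varepsilon\to0^+}\Bigl\{t^{-\alpha}[v(\varepsilon)-v(0)]+\int_\varepsilon^t(t-s)^{-\alpha}\,\partial_sv(s)\,ds\Bigr\},$$ with $v$ locally absolutely continuous on $(0,t]$ (thus the integral is improper at $0$, and a jump of $v$ at $t=0$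 contributes a multiple of the Dirac delta-function to $\partial_s v$; the term $t^{-\alpha}[v(\varepsilon)-v(0)]$ vanishes in the limit if $v$ is right-continuous at $0$). Let $f(\cdot,t)\in L_{1,\mathrm{loc}}(\Omega)$ for $0<t\le T$ and $u_0\in L_2(\Omega)$. Let $u$ be a solution of $D_t^\alpha u+\mathcal L u=f$ for $0<t\le T$ (in the sense of distributions on $\Omega$ for each $t$) with $u(\cdot,0)=u_0$. Let $u$ and its approximation $u_h$ be in $L_\infty(0,t;L_2(\Omega))\cap W^{1,\infty}(\epsilon,t;L_2(\Omega))$ for any $0<\epsilon<t\le T$, and also in $H_0^1(\Omega)$ for each $0<t\le T$. Suppose that $u_h:[0,T]\to L_2(\Omega)$ is continuous; it is not required that $u_h(\cdot,0)=u_0$. Suppose that for $0<t\le T$ the modified residual $$R_h(\cdot,t)=[u_h(\cdot,0)-u_0]\,\frac{t^{-\alpha}}{\Gamma(1-\alpha)}+(D_t^\alpha+\mathcal L)u_h(\cdot,t)-f(\cdot,t)$$ is in $L_2(\Omega)$, and set $e:=u_h-u$. Then the following hold. (i) For all $0<t\le T$, $$\|e(\cdot,t)\|\le(D_t^\alpha+\lambda)^{-1}\|R_h(\cdot,t)\|:=\int_0^t(t-s)^{\alpha-1}E_{\alpha,\alpha}(-\lambda[t-s]^\alpha)\,\|R_h(\cdot,s)\|\,ds,\qquad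 E_{\alpha,\beta}(s)=\sum_{k=0}^\infty\frac{s^k}{\Gamma(\alpha k+\beta)},$$ where the integral, whose integrand is non-negative, may equal $+\infty$. (ii) If $\mathcal E:[0,T]\to[0,\infty)$ is such that $D_t^\alpha\mathcal E(t)$ exists and $\|R_h(\cdot,t)\|\le(D_t^\alpha+\lambda)\mathcal E(t)$ for all $0<t\le T$, then $\|e(\cdot,t)\|\le\mathcal E(t)$ for all $0<t\le T$; this bound holds also at $t=0$ if $\mathcal E$ and $u$ are right-continuous at $0$. (iii) If $\lambda\ge0$, then for every $\tau>0$ and all $0<t\le T$ (with suprema in $[0,\infty]$) $$\|e(\cdot,t)\|\le\sup_{0<s\le t}\frac{\|R_h(\cdot,s)\|}{\mathcal R_0(s)},\qquad \|e(\cdot,t)\|\le t^{\alpha-1}\sup_{0<s\le t}\frac{\|R_h(\cdot,s)\|}{\mathcal R_1(s)},\qquad \|e(\cdot,t)\|\le\mathcal E_1(t)\sup_{0<s\le t}\frac{\|R_h(\cdot,s)\|}{\mathcal R_1(s)},$$ where, with $\beta:=1-\alpha$ and $v^+:=\max\{0,v\}$, $\mathcal R_0(t)=\frac{t^{-\alpha}}{\Gamma(1-\alpha)}+\lambda$,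 $\mathcal R_1(t)=\frac{t^{-1}\rho(\tau/t)}{\Gamma(1-\alpha)}+\lambda\,\mathcal E_1(t)$, $\mathcal E_1(t)=\max\{\tau,t\}^{\alpha-1}$, and $\rho(s)=s^{-\beta}[1-((1-s)^+)^\beta]\ge s^{-\beta}\min\{\beta s,1\}$ for $s>0$. -/

import Mathlib

open Set Filter Topology MeasureTheory
open scoped ENNReal ContDiff

noncomputable section

namespace FracParabolic

/-! ### Functions of time with values in a normed space -/

section Time

variable {X : Type*} [NormedAddCommGroup X] [NormedSpace ℝ X]

/-- On `[a, b]` the function `v` is absolutely continuous, with (weak) derivative `g ∈ L¹(a, b; X)`. -/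
def HasTimeDeriv (v g : ℝ → X) (a b : ℝ) : Prop :=
  IntervalIntegrable g volume a b ∧ ∀ s ∈ Icc a b, v s = v a + ∫ r in a..s, g r

/-- `v ∈ W^{1,∞}(a, b; X)` (`v` being the continuous representative): the derivative is in
`L_∞(a, b; X)`. -/
def MemW1Inf (v : ℝ → X) (a b : ℝ) : Prop :=
  ∃ g : ℝ → X, MemLp g ∞ (volume.restrict (Ioo a b)) ∧ HasTimeDeriv v g a b

/-- `v ∈ L_∞(0, t; X) ∩ W^{1,∞}(ε, t; X)` for any `0 < ε < t ≤ T`. -/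
def TimeRegular (T : ℝ) (v : ℝ → X) : Prop :=
  ∀ ε t : ℝ, 0 < ε → ε < t → t ≤ T →
    MemLp v ∞ (volume.restrict (Ioo 0 t)) ∧ MemW1Inf v ε t

/-- The Caputo derivative `D_t^α v (t) = Γ(1-α)⁻¹ ∫_0^t (t-s)^{-α} ∂_s v(s) ds` exists and equals `w`.

Here `∂_s v` is the distributional derivative, which on `(0, t]` is a function `g`. Since `g` need
not be integrable near `0`, the integral is improper at `0`; a jump of `v` at the initial
time contributes `t^{-α} (v(0+) - v(0))`, as `∂_s v` then contains `(v(0+) - v(0)) δ(s)`. If `v` is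
right-continuous at `0`, the term `t^{-α} (v(ε) - v(0))` vanishes in the limit; if moreover
`(t-s)^{-α} g(s)` is integrable on `(0, t)`, the limit is the Lebesgue integral. -/
def HasCaputoDerivAt (α : ℝ) (v : ℝ → X) (t : ℝ) (w : X) : Prop :=
  ∃ g : ℝ → X,
    (∀ ε ∈ Ioo 0 t, HasTimeDeriv v g ε t ∧
      IntervalIntegrable (fun s => (t - s) ^ (-α) • g s) volume ε t) ∧
    Tendsto (fun ε : ℝ => (Real.Gamma (1 - α))⁻¹ •
        (t ^ (-α) • (v ε - v 0) + ∫ s in ε..t, (t - s) ^ (-α) • g s))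
      (𝓝[>] 0) (𝓝 w)

end Time

/-! ### The operator `(D_t^α + μ)⁻¹` and the residual barriers -/

/-- The generalized Mittag-Leffler function `E_{α,β}(s) = ∑_k s^k / Γ(α k + β)`. -/
def mittagLeffler (α β s : ℝ) : ℝ :=
  ∑' k : ℕ, (Real.Gamma (α * k + β))⁻¹ * s ^ k

/-- `(D_t^α + μ)⁻¹ v (t) = ∫_0^t (t-s)^{α-1} E_{α,α}(-μ (t-s)^α) v(s) ds` for `v ≥ 0`, as a
Lebesgue integral with values in `[0, ∞]` (the kernel is positive for `0 < α < 1`). -/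
def caputoInv (α μ : ℝ) (v : ℝ → ℝ≥0∞) (t : ℝ) : ℝ≥0∞ :=
  ∫⁻ s in Ioo 0 t,
    ENNReal.ofReal ((t - s) ^ (α - 1) * mittagLeffler α α (-μ * (t - s) ^ α)) * v s

/-- `R₀(t) = t^{-α} / Γ(1-α) + μ`. -/
def barrierR0 (α μ t : ℝ) : ℝ := (Real.Gamma (1 - α))⁻¹ * t ^ (-α) + μ

/-- `E₁(t) = max{τ, t}^{α-1}`. -/
def barrierE1 (α τ t : ℝ) : ℝ := max τ t ^ (α - 1)

/-- `ρ(s) = s^{-β} [1 - ((1-s)^+)^β]`, `β = 1 - α`. -/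
def barrierRho (α s : ℝ) : ℝ := s ^ (-(1 - α)) * (1 - max 0 (1 - s) ^ (1 - α))

/-- `R₁(t) = t^{-1} ρ(τ/t) / Γ(1-α) + μ E₁(t)`. -/
def barrierR1 (α μ τ t : ℝ) : ℝ :=
  (Real.Gamma (1 - α))⁻¹ * t⁻¹ * barrierRho α (τ / t) + μ * barrierE1 α τ t

/-! ### Function spaces on `Ω ⊆ ℝ^d` and elliptic operators -/

/-- `ℝ^d` with the Euclidean norm. -/
abbrev Space (d : ℕ) : Type := EuclideanSpace ℝ (Fin d)

variable {d : ℕ}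

/-- `L_2(Ω)`. -/
abbrev L2 (Ω : Set (Space d)) : Type := Lp ℝ 2 (volume.restrict Ω)

/-- `L_2(Ω)^d`. -/
abbrev L2Vec (Ω : Set (Space d)) : Type := Lp (Space d) 2 (volume.restrict Ω)

/-- `φ ∈ C_c^∞(Ω)`. -/
def IsTestFunction (Ω : Set (Space d)) (φ : Space d → ℝ) : Prop :=
  ContDiff ℝ ∞ φ ∧ HasCompactSupport φ ∧ tsupport φ ⊆ Ω

/-- The pairs `(v, ∇v)` with `v ∈ H^1_0(Ω)`: the space `H^1_0(Ω)` is the closure of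
`C_c^∞(Ω)` in the norm of `H^1(Ω)`, i.e. with respect to `L_2` convergence of functions and
gradients. -/
def H10Graph (Ω : Set (Space d)) : Set (L2 Ω × L2Vec Ω) :=
  closure {p | ∃ φ : Space d → ℝ, IsTestFunction Ω φ ∧
    p.1 =ᵐ[volume.restrict Ω] φ ∧ p.2 =ᵐ[volume.restrict Ω] gradient φ}

/-- A linear second-order uniformly elliptic operator
`ℒ v = - ∑ᵢⱼ ∂ᵢ(aᵢⱼ ∂ⱼ v) - ∑ᵢ ∂ᵢ(pᵢ v) + ∑ᵢ bᵢ ∂ᵢ v + c v` in `Ω` with coefficients in `L_∞(Ω)`. -/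
structure EllipticOperator (Ω : Set (Space d)) where
  a : Space d → Fin d → Fin d → ℝ
  p : Space d → Fin d → ℝ
  b : Space d → Fin d → ℝ
  c : Space d → ℝ
  a_mem : ∀ i j, MemLp (fun x => a x i j) ∞ (volume.restrict Ω)
  p_mem : ∀ i, MemLp (fun x => p x i) ∞ (volume.restrict Ω)
  b_mem : ∀ i, MemLp (fun x => b x i) ∞ (volume.restrict Ω)
  c_mem : MemLp c ∞ (volume.restrict Ω)
  elliptic : ∃ θ : ℝ, 0 < θ ∧ ∀ᵐ x ∂(volume.restrict Ω), ∀ ξ : Space d,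
    θ * ‖ξ‖ ^ 2 ≤ ∑ i, ∑ j, a x i j * ξ j * ξ i

/-- The pairing `⟨ℒ v, w⟩`, where `V = ∇v` and `W = ∇w`. -/
def EllipticOperator.pairing {Ω : Set (Space d)} (L : EllipticOperator Ω)
    (v : Space d → ℝ) (V : Space d → Space d) (w : Space d → ℝ) (W : Space d → Space d) : ℝ :=
  ∫ x in Ω, ((∑ i, ∑ j, L.a x i j * V x j * W x i) + (∑ i, L.p x i * v x * W x i)
    + (∑ i, L.b x i * V x i * w x) + L.c x * v x * w x)

/-- `⟨ℒ v, v⟩ ≥ μ ‖v‖²` for all `v ∈ H^1_0(Ω)`. -/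
def EllipticOperator.LowerBound {Ω : Set (Space d)} (L : EllipticOperator Ω) (μ : ℝ) : Prop :=
  ∀ (v : L2 Ω) (V : L2Vec Ω), (v, V) ∈ H10Graph Ω → μ * ‖v‖ ^ 2 ≤ L.pairing v V v V

/-- `u` solves `D_t^α u + ℒ u = f` in `Ω × (0, T]` (in the sense of distributions on `Ω` for each
`t`), with `u(·, t) ∈ H^1_0(Ω)` for `t > 0` and `u(·, 0) = u₀`. -/
def IsSolution (Ω : Set (Space d)) (L : EllipticOperator Ω) (α T : ℝ)
    (f : ℝ → Space d → ℝ) (u₀ : L2 Ω) (u : ℝ → L2 Ω) : Prop :=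
  u 0 = u₀ ∧ ∀ t ∈ Ioc 0 T, ∃ (U : L2Vec Ω) (Du : L2 Ω),
    (u t, U) ∈ H10Graph Ω ∧ HasCaputoDerivAt α u t Du ∧
    ∀ φ : Space d → ℝ, IsTestFunction Ω φ →
      (∫ x in Ω, Du x * φ x) + L.pairing (u t) U φ (gradient φ) = ∫ x in Ω, f t x * φ x

/-- `u_h(·, t) ∈ H^1_0(Ω)` for `t > 0`, and the functions `R(·, t) ∈ L_2(Ω)`, `0 < t ≤ T`, are the
residual of `u_h`, corrected for the initial error:
`R(·,t) = [u_h(·,0) - u₀] t^{-α} / Γ(1-α) + (D_t^α + ℒ) u_h(·,t) - f(·,t)` in the sense of distributions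
on `Ω`. -/
def IsModifiedResidual (Ω : Set (Space d)) (L : EllipticOperator Ω) (α T : ℝ)
    (f : ℝ → Space d → ℝ) (u₀ : L2 Ω) (uh R : ℝ → L2 Ω) : Prop :=
  ∀ t ∈ Ioc 0 T, ∃ (U : L2Vec Ω) (Duh : L2 Ω),
    (uh t, U) ∈ H10Graph Ω ∧ HasCaputoDerivAt α uh t Duh ∧
    ∀ φ : Space d → ℝ, IsTestFunction Ω φ →
      ∫ x in Ω, R t x * φ x =
        (∫ x in Ω, (uh 0 x - u₀ x) * (Real.Gamma (1 - α))⁻¹ * t ^ (-α) * φ x)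
          + (∫ x in Ω, Duh x * φ x) + L.pairing (uh t) U φ (gradient φ)
          - ∫ x in Ω, f t x * φ x

end FracParabolic

end

/-!
Subtracting the equations for `u` and `u_h` and testing with `e(t)` gives, because `ℒ ≥ μ`,
`⟨D_t^α e + Γ(1-α)⁻¹ t^{-α} e(0), e⟩ + μ ‖e‖² ≤ ‖R_h‖ ‖e‖`; the extra term replaces the initial
value `e(0)` by `0`. Since `⟨e(s), e(t)⟩ ≤ ‖e(s)‖ ‖e(t)‖` with equality at `s = t`, the left-hand
side dominates `‖e‖ (D_t^α + μ) ‖e‖`, so the scalar function `‖e‖`, with initial value `0`,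
satisfies `(D_t^α + μ) ‖e‖ ≤ ‖R_h‖`.

The scalar inequality is inverted with the kernel `k(x) = x^{α-1} E_{α,α}(-μ x^α)`. It is positive,
and `k * R₀ = 1`, where `R₀(x) = x^{-α} / Γ(1-α) + μ` is the kernel through which `D_t^α + μ` acts
on `∂_t v`. As `∂_t ‖e‖` need not be integrable at `0`, one works on `[ε, t]` with the value
`‖e(ε)‖` as the initial jump and lets `ε → 0`; since `‖e‖` is bounded, the error this introduces
vanishes. For a non-negative barrier the truncation only increases `(D_t^α + μ) ℰ`. The barriers
`R₀` and `R₁` are `(D_t^α + μ)` applied to the unit step and to `ℰ₁` with the value `0` at `t = 0`.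
-/

namespace FracParabolic

/-! ### The kernel of `(D_t^α + μ)⁻¹` -/

theorem rpow_mul_exp_le_Gamma {y M : ℝ} (hy : 0 < y) (hM : 0 < M) :
    M ^ y * (Real.exp (-(M + 1)) / (M + 1)) ≤ Real.Gamma y := by
  rw [Real.Gamma_eq_integral hy]
  have hint := Real.GammaIntegral_convergent hy
  have hsub : Ioc M (M + 1) ⊆ Ioi 0 := fun x hx => hM.trans hx.1
  calc M ^ y * (Real.exp (-(M + 1)) / (M + 1))
      = ∫ x in Ioc M (M + 1), M ^ y * (Real.exp (-(M + 1)) / (M + 1)) := by simp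
    _ ≤ ∫ x in Ioc M (M + 1), Real.exp (-x) * x ^ (y - 1) := by
        refine setIntegral_mono_on (integrableOn_const (by simp)) (hint.mono_set hsub)
          measurableSet_Ioc fun x hx => ?_
        have hx0 : 0 < x := hM.trans hx.1
        calc M ^ y * (Real.exp (-(M + 1)) / (M + 1))
            ≤ x ^ y * (Real.exp (-x) / x) := by
              gcongr
              exacts [hx.1.le, hx.2, hx.2]
          _ = Real.exp (-x) * x ^ (y - 1) := by
              rw [Real.rpow_sub_one hx0.ne']
              ring
    _ ≤ ∫ x in Ioi 0, Real.exp (-x) * x ^ (y - 1) := by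
        refine setIntegral_mono_set hint ?_ hsub.eventuallyLE
        filter_upwards [ae_restrict_mem measurableSet_Ioi] with x (hx : 0 < x)
        positivity

theorem summable_mittagLeffler {α β : ℝ} (hα : 0 < α) (hβ : 0 < β) (s : ℝ) :
    Summable fun k : ℕ => (Real.Gamma (α * k + β))⁻¹ * s ^ k := by
  obtain ⟨M, hM0, hM⟩ : ∃ M : ℝ, 0 < M ∧ |s| < M ^ α :=
    ((eventually_gt_atTop 0).and ((tendsto_rpow_atTop hα).eventually_gt_atTop |s|)).exists
  set C : ℝ := Real.exp (-(M + 1)) / (M + 1)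
  have hC : 0 < C := by positivity
  have hq : |s| / M ^ α < 1 := (div_lt_one (by positivity)).2 hM
  refine Summable.of_norm_bounded
    ((summable_geometric_of_lt_one (by positivity) hq).mul_left (M ^ β * C)⁻¹) fun k => ?_
  have hy : 0 < α * k + β := by positivity
  have hΓ := Real.Gamma_pos_of_pos hy
  calc ‖(Real.Gamma (α * k + β))⁻¹ * s ^ k‖ = (Real.Gamma (α * k + β))⁻¹ * |s| ^ k := by
        rw [norm_mul, norm_pow, Real.norm_eq_abs, Real.norm_eq_abs, abs_of_pos (inv_pos.2 hΓ)]
    _ ≤ (M ^ (α * k + β) * C)⁻¹ * |s| ^ k := by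
        gcongr
        exact rpow_mul_exp_le_Gamma hy hM0
    _ = (M ^ β * C)⁻¹ * (|s| / M ^ α) ^ k := by
        rw [Real.rpow_add hM0, div_pow, ← Real.rpow_mul_natCast hM0.le]
        field_simp

theorem mittagLeffler_zero {α β : ℝ} : mittagLeffler α β 0 = (Real.Gamma β)⁻¹ := by
  rw [mittagLeffler, tsum_eq_single 0 fun k hk => by simp [hk]]
  simp

theorem continuous_mittagLeffler {α β : ℝ} (hα : 0 < α) (hβ : 0 < β) :
    Continuous (mittagLeffler α β) := by
  rw [continuous_iff_continuousAt]
  intro s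
  have h : ContinuousOn (mittagLeffler α β) (Icc (-(|s| + 1)) (|s| + 1)) := by
    refine continuousOn_tsum (fun k => by fun_prop) (summable_mittagLeffler hα hβ (|s| + 1))
      fun k x hx => ?_
    have hΓ := Real.Gamma_pos_of_pos (show 0 < α * k + β by positivity)
    rw [norm_mul, norm_pow, Real.norm_eq_abs, Real.norm_eq_abs, abs_of_pos (inv_pos.2 hΓ)]
    gcongr
    exact abs_le.2 hx
  exact h.continuousAt (Icc_mem_nhds (by linarith [neg_abs_le s]) (by linarith [le_abs_self s]))

/-- The kernel `x^{β-1} E_{α,β}(c x^α)`; for `β = α` and `c = -μ` it is the kernel of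
`(D_t^α + μ)⁻¹`. -/
noncomputable def fracKernel (α β c x : ℝ) : ℝ := x ^ (β - 1) * mittagLeffler α β (c * x ^ α)

theorem hasSum_fracKernel {α β x : ℝ} (c : ℝ) (hα : 0 < α) (hβ : 0 < β) (hx : 0 < x) :
    HasSum (fun k : ℕ => (Real.Gamma (α * k + β))⁻¹ * c ^ k * x ^ (α * k + β - 1))
      (fracKernel α β c x) := by
  refine ((summable_mittagLeffler hα hβ (c * x ^ α)).hasSum.mul_left (x ^ (β - 1))).congr_fun
    fun k => ?_
  rw [add_sub_assoc, Real.rpow_add hx, Real.rpow_mul_natCast hx.le, mul_pow]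
  ring

theorem fracKernel_eq_add {α β c x : ℝ} (hα : 0 < α) (hβ : 0 < β) (hx : 0 < x) :
    fracKernel α β c x = (Real.Gamma β)⁻¹ * x ^ (β - 1) + c * fracKernel α (α + β) c x := by
  have h := hasSum_fracKernel c hα hβ hx
  rw [← h.tsum_eq, h.summable.tsum_eq_zero_add,
    ← (hasSum_fracKernel c hα (add_pos hα hβ) hx).tsum_eq, ← tsum_mul_left]
  congr 1
  · simp
  · refine tsum_congr fun k => ?_
    push_cast
    rw [pow_succ, mul_add, mul_one, add_assoc]
    ring

theorem continuousOn_fracKernel {α β c : ℝ} (hα : 0 < α) (hβ : 0 < β) :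
    ContinuousOn (fracKernel α β c) (Ioi 0) := by
  refine ContinuousOn.mul ?_ ((continuous_mittagLeffler hα hβ).comp_continuousOn ?_)
  · exact fun x hx => (Real.continuousAt_rpow_const x _ (Or.inl (ne_of_gt hx))).continuousWithinAt
  · exact (continuous_const.mul (Real.continuous_rpow_const hα.le)).continuousOn

theorem measurable_fracKernel {α β c : ℝ} (hα : 0 < α) (hβ : 0 < β) :
    Measurable (fracKernel α β c) := by
  have := (continuous_mittagLeffler hα hβ).measurable
  unfold fracKernel
  fun_prop

theorem intervalIntegrable_sub_rpow {p a t : ℝ} (hp : -1 < p) :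
    IntervalIntegrable (fun s => (t - s) ^ p) volume a t := by
  simpa using (intervalIntegral.intervalIntegrable_rpow' (a := t - a) (b := 0) hp).comp_sub_left t

theorem integral_sub_rpow {p a t : ℝ} (hp : -1 < p) :
    ∫ s in a..t, (t - s) ^ p = (t - a) ^ (p + 1) / (p + 1) := by
  rw [intervalIntegral.integral_comp_sub_left (fun y => y ^ p) t, sub_self,
    integral_rpow (Or.inl hp), Real.zero_rpow (by linarith), sub_zero]

theorem integral_sub_rpow_mul_rpow {a b x : ℝ} (ha : 0 < a) (hb : 0 < b) (hx : 0 < x) :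
    ∫ y in 0..x, (x - y) ^ (a - 1) * y ^ (b - 1) =
      Real.Gamma a * Real.Gamma b / Real.Gamma (a + b) * x ^ (a + b - 1) := by
  have h := Complex.betaIntegral_scaled b a hx
  rw [Complex.betaIntegral_eq_Gamma_mul_div _ _ (by simpa) (by simpa), ← Complex.ofReal_add,
    Complex.Gamma_ofReal, Complex.Gamma_ofReal, Complex.Gamma_ofReal] at h
  have hcast : ∫ y in 0..x, (y : ℂ) ^ ((b : ℂ) - 1) * ((x : ℂ) - y) ^ ((a : ℂ) - 1) =
      ∫ y in 0..x, (((x - y) ^ (a - 1) * y ^ (b - 1) : ℝ) : ℂ) := by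
    refine intervalIntegral.integral_congr fun y hy => ?_
    rw [uIcc_of_le hx.le] at hy
    push_cast [Complex.ofReal_cpow hy.1, Complex.ofReal_cpow (sub_nonneg.2 hy.2)]
    ring
  rw [hcast, intervalIntegral.integral_ofReal, ← Complex.ofReal_one, ← Complex.ofReal_sub,
    ← Complex.ofReal_cpow hx.le] at h
  rw [add_comm a b, mul_comm (Real.Gamma a), mul_comm _ (x ^ _)]
  exact_mod_cast h

theorem intervalIntegrable_sub_rpow_mul_rpow {a b x : ℝ} (ha : 0 < a) (hb : 0 < b) (hx : 0 < x) :
    IntervalIntegrable (fun y => (x - y) ^ (a - 1) * y ^ (b - 1)) volume 0 x := by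
  refine intervalIntegral.intervalIntegrable_of_integral_ne_zero ?_
  rw [integral_sub_rpow_mul_rpow ha hb hx]
  have := Real.Gamma_pos_of_pos ha
  have := Real.Gamma_pos_of_pos hb
  have := Real.Gamma_pos_of_pos (add_pos ha hb)
  positivity

theorem intervalIntegrable_sub_rpow_mul_fracKernel {α β a c x : ℝ} (hα : 0 < α) (hβ : 0 < β)
    (ha : 0 < a) (hx : 0 < x) :
    IntervalIntegrable (fun y => (x - y) ^ (a - 1) * fracKernel α β c y) volume 0 x := by
  have h := (intervalIntegrable_sub_rpow_mul_rpow ha hβ hx).mul_continuousOn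
    (g := fun y => mittagLeffler α β (c * y ^ α))
    ((continuous_mittagLeffler hα hβ).comp
      (continuous_const.mul (Real.continuous_rpow_const hα.le))).continuousOn
  exact h.congr fun y _ => mul_assoc _ _ _

theorem intervalIntegrable_fracKernel {α β c x : ℝ} (hα : 0 < α) (hβ : 0 < β) (hx : 0 < x) :
    IntervalIntegrable (fracKernel α β c) volume 0 x := by
  simpa using intervalIntegrable_sub_rpow_mul_fracKernel (c := c) hα hβ one_pos hx

theorem integral_sub_rpow_mul_fracKernel_term {α β a x : ℝ} (c : ℝ) (hα : 0 < α) (hβ : 0 < β)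
    (ha : 0 < a) (hx : 0 < x) (k : ℕ) :
    ∫ y in 0..x, (x - y) ^ (a - 1) *
        ((Real.Gamma (α * k + β))⁻¹ * c ^ k * y ^ (α * k + β - 1)) =
      Real.Gamma a *
        ((Real.Gamma (α * k + (a + β)))⁻¹ * c ^ k * x ^ (α * k + (a + β) - 1)) := by
  have hk : 0 < α * k + β := by positivity
  have hΓ := (Real.Gamma_pos_of_pos hk).ne'
  simp_rw [mul_left_comm ((x - _) ^ (a - 1))]
  rw [intervalIntegral.integral_const_mul, integral_sub_rpow_mul_rpow ha hk hx,
    add_left_comm a]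
  field_simp

theorem integral_sub_rpow_mul_fracKernel {α β a c x : ℝ} (hα : 0 < α) (hβ : 0 < β)
    (ha : 0 < a) (hx : 0 < x) :
    ∫ y in 0..x, (x - y) ^ (a - 1) * fracKernel α β c y =
      Real.Gamma a * fracKernel α (a + β) c x := by
  let F (c : ℝ) (k : ℕ) (y : ℝ) : ℝ :=
    (x - y) ^ (a - 1) * ((Real.Gamma (α * k + β))⁻¹ * c ^ k * y ^ (α * k + β - 1))
  have hF (c : ℝ) : HasSum (fun k => ∫ y in Ioc 0 x, F c k y)
      (Real.Gamma a * fracKernel α (a + β) c x) := by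
    simp_rw [← intervalIntegral.integral_of_le hx.le, F,
      integral_sub_rpow_mul_fracKernel_term c hα hβ ha hx]
    exact (hasSum_fracKernel c hα (add_pos ha hβ) hx).mul_left _
  have hint (k : ℕ) : Integrable (F c k) (volume.restrict (Ioc 0 x)) := by
    refine (((intervalIntegrable_sub_rpow_mul_rpow ha (show 0 < α * k + β by positivity)
      hx).const_mul ((Real.Gamma (α * k + β))⁻¹ * c ^ k)).congr fun y _ => ?_).1
    exact mul_left_comm _ _ _
  have hnorm (k : ℕ) : ∫ y in Ioc 0 x, ‖F c k y‖ = ∫ y in Ioc 0 x, F |c| k y := by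
    refine setIntegral_congr_fun measurableSet_Ioc fun y hy => ?_
    have hΓ := Real.Gamma_pos_of_pos (show 0 < α * k + β by positivity)
    simp only [F, norm_mul, norm_inv, norm_pow, Real.norm_eq_abs, abs_of_pos hΓ,
      abs_of_nonneg (Real.rpow_nonneg (sub_nonneg.2 hy.2) _),
      abs_of_nonneg (Real.rpow_nonneg hy.1.le _)]
  have hsum : Summable fun k => ∫ y in Ioc 0 x, ‖F c k y‖ := by
    simp_rw [hnorm]
    exact (hF |c|).summable
  rw [(hF c).unique (hasSum_integral_of_summable_integral_norm hint hsum),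
    intervalIntegral.integral_of_le hx.le]
  refine setIntegral_congr_fun measurableSet_Ioc fun y hy => ?_
  rw [← (hasSum_fracKernel c hα hβ hy.1).tsum_eq, ← tsum_mul_left]

theorem Gamma_mul_fracKernel_self {α c x : ℝ} (hα : 0 < α) (hx : 0 < x) :
    Real.Gamma α * fracKernel α α c x =
      x ^ (α - 1) + c * ∫ y in 0..x, (x - y) ^ (α - 1) * fracKernel α α c y := by
  rw [integral_sub_rpow_mul_fracKernel hα hα hα hx, fracKernel_eq_add hα hα hx, mul_add,
    mul_inv_cancel_left₀ (Real.Gamma_pos_of_pos hα).ne']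
  ring

theorem integral_sub_rpow_mul_le_div_rpow_mul {f : ℝ → ℝ} {p x t : ℝ} (hp : p ≤ 0) (hx : 0 < x)
    (hxt : x ≤ t) (hf : ∀ y ∈ Ioo 0 x, 0 ≤ f y)
    (hft : IntervalIntegrable (fun y => (t - y) ^ p * f y) volume 0 x)
    (hfx : IntervalIntegrable (fun y => (x - y) ^ p * f y) volume 0 x) :
    ∫ y in 0..x, (t - y) ^ p * f y ≤ (t / x) ^ p * ∫ y in 0..x, (x - y) ^ p * f y := by
  have ht : 0 < t := hx.trans_le hxt
  rw [← intervalIntegral.integral_const_mul]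
  refine intervalIntegral.integral_mono_on_of_le_Ioo hx.le hft (hfx.const_mul _) fun y hy => ?_
  have hxy : 0 < x - y := sub_pos.2 hy.2
  rw [← mul_assoc, ← Real.mul_rpow (by positivity) hxy.le]
  refine mul_le_mul_of_nonneg_right (Real.rpow_le_rpow_of_nonpos (by positivity) ?_ hp) (hf y hy)
  rw [div_mul_eq_mul_div, div_le_iff₀ hx]
  nlinarith [hy.1]

theorem integral_sub_rpow_mul_le {f : ℝ → ℝ} {p x t M : ℝ} (hp : -1 < p) (hxt : x ≤ t)
    (hf : ∀ y ∈ Icc x t, f y ≤ M)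
    (hft : IntervalIntegrable (fun y => (t - y) ^ p * f y) volume x t) :
    ∫ y in x..t, (t - y) ^ p * f y ≤ M * ((t - x) ^ (p + 1) / (p + 1)) := by
  rw [← integral_sub_rpow hp, ← intervalIntegral.integral_const_mul]
  refine intervalIntegral.integral_mono_on hxt hft
    ((intervalIntegrable_sub_rpow hp).const_mul _) fun y hy => ?_
  rw [mul_comm]
  exact mul_le_mul_of_nonneg_right (hf y hy) (Real.rpow_nonneg (sub_nonneg.2 hy.2) _)

-- Insert the bounds for the integrals over `(0, x)` and `(x, t)` into the Volterra equation at `t`,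
-- then use the Volterra equation at `x`; the power singularity scales exactly.
theorem fracKernel_mul_le_Gamma_mul_fracKernel {α c x t : ℝ} (hα0 : 0 < α) (hα1 : α ≤ 1)
    (hc : c ≤ 0) (hx : 0 < x) (hxt : x ≤ t) (hpos : ∀ y ∈ Ioo 0 x, 0 ≤ fracKernel α α c y)
    (hmax : ∀ y ∈ Icc x t, fracKernel α α c y ≤ fracKernel α α c x) :
    fracKernel α α c x * (Real.Gamma α * (t / x) ^ (α - 1) + c * ((t - x) ^ α / α)) ≤
      Real.Gamma α * fracKernel α α c t := by
  have ht : 0 < t := hx.trans_le hxt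
  have hIx := intervalIntegrable_sub_rpow_mul_fracKernel (c := c) hα0 hα0 hα0 hx
  have hIt := intervalIntegrable_sub_rpow_mul_fracKernel (c := c) hα0 hα0 hα0 ht
  have hx_mem : x ∈ uIcc 0 t := by
    rw [uIcc_of_le ht.le]
    exact ⟨hx.le, hxt⟩
  have hI0x := hIt.mono_set (uIcc_subset_uIcc_left hx_mem)
  have hIxt := hIt.mono_set (uIcc_subset_uIcc_right hx_mem)
  have hfar := integral_sub_rpow_mul_le_div_rpow_mul (sub_nonpos.2 hα1) hx hxt hpos hI0x hIx
  have hnear := integral_sub_rpow_mul_le (by linarith) hxt hmax hIxt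
  rw [sub_add_cancel] at hnear
  have hvolterra_x := Gamma_mul_fracKernel_self (c := c) hα0 hx
  have hscale : t ^ (α - 1) = (t / x) ^ (α - 1) * x ^ (α - 1) := by
    rw [← Real.mul_rpow (by positivity) hx.le, div_mul_cancel₀ _ hx.ne']
  rw [Gamma_mul_fracKernel_self hα0 ht, hscale,
    ← intervalIntegral.integral_add_adjacent_intervals hI0x hIxt]
  calc _ = (t / x) ^ (α - 1) * x ^ (α - 1) +
        c * ((t / x) ^ (α - 1) * (∫ y in 0..x, (x - y) ^ (α - 1) * fracKernel α α c y) +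
          fracKernel α α c x * ((t - x) ^ α / α)) := by
        linear_combination (t / x) ^ (α - 1) * hvolterra_x
    _ ≤ _ := by
        gcongr _ + ?_
        exact mul_le_mul_of_nonpos_left (add_le_add hfar hnear) hc

theorem fracKernel_pos_of_pos_on_Ioo {α c t : ℝ} (hα0 : 0 < α) (hα1 : α ≤ 1) (hc : c ≤ 0)
    (ht : 0 < t) (hpos : ∀ x ∈ Ioo 0 t, 0 < fracKernel α α c x) : 0 < fracKernel α α c t := by
  have hΓ := Real.Gamma_pos_of_pos hα0
  have hcoeff : ∀ᶠ x in 𝓝[<] t, 0 < Real.Gamma α * (t / x) ^ (α - 1) + c * ((t - x) ^ α / α) := by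
    have hcont : ContinuousAt
        (fun x => Real.Gamma α * (t / x) ^ (α - 1) + c * ((t - x) ^ α / α)) t := by
      have h1 : ContinuousAt (fun x : ℝ => (t / x) ^ (α - 1)) t :=
        (continuousAt_const.div continuousAt_id ht.ne').rpow_const (Or.inl (by simp [ht.ne']))
      have h2 : ContinuousAt (fun x : ℝ => (t - x) ^ α) t :=
        (continuousAt_const.sub continuousAt_id).rpow_const (Or.inr hα0.le)
      exact (h1.const_mul _).add ((h2.div_const _).const_mul _)
    refine (hcont.eventually_const_lt ?_).filter_mono nhdsWithin_le_nhds
    simpa [div_self ht.ne', Real.zero_rpow hα0.ne'] using hΓ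
  obtain ⟨t₁, ht₁, hsub⟩ := (mem_nhdsLT_iff_exists_mem_Ico_Ioo_subset (half_lt_self ht)).1 hcoeff
  obtain ⟨t₂, ht₁₂, ht₂⟩ := exists_between ht₁.2
  have ht₂0 : 0 < t₂ := (half_pos ht).trans_le (ht₁.1.trans ht₁₂.le)
  obtain ⟨x, hx, hmax⟩ := isCompact_Icc.exists_isMaxOn (nonempty_Icc.2 ht₂.le)
    ((continuousOn_fracKernel (c := c) hα0 hα0).mono fun y hy => ht₂0.trans_le hy.1)
  have hx0 : 0 < x := ht₂0.trans_le hx.1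
  have hposx : 0 < fracKernel α α c x :=
    (hpos t₂ ⟨ht₂0, ht₂⟩).trans_le (hmax (left_mem_Icc.2 ht₂.le))
  rcases hx.2.eq_or_lt with rfl | hxt
  · exact hposx
  have h := fracKernel_mul_le_Gamma_mul_fracKernel hα0 hα1 hc hx0 hx.2
    (fun y hy => (hpos y ⟨hy.1, hy.2.trans hxt⟩).le) fun y hy => hmax ⟨hx.1.trans hy.1, hy.2⟩
  exact pos_of_mul_pos_right ((mul_pos hposx (hsub ⟨ht₁₂.trans_le hx.1, hxt⟩)).trans_le h) hΓ.le

theorem eventually_fracKernel_pos {α c : ℝ} (hα : 0 < α) :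
    ∀ᶠ x in 𝓝[>] 0, 0 < fracKernel α α c x := by
  have hc : ContinuousAt (fun x : ℝ => mittagLeffler α α (c * x ^ α)) 0 :=
    ((continuous_mittagLeffler hα hα).comp
      (continuous_const.mul (Real.continuous_rpow_const hα.le))).continuousAt
  have h0 : 0 < mittagLeffler α α (c * (0 : ℝ) ^ α) := by
    rw [Real.zero_rpow hα.ne', mul_zero, mittagLeffler_zero]
    exact inv_pos.2 (Real.Gamma_pos_of_pos hα)
  filter_upwards [(hc.eventually_const_lt h0).filter_mono nhdsWithin_le_nhds,
    self_mem_nhdsWithin] with x hx hx0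
  exact mul_pos (Real.rpow_pos_of_pos hx0 _) hx

theorem pos_of_eventually_pos_of_pos_on_Ioo {f : ℝ → ℝ} (hf : ContinuousOn f (Ioi 0))
    (h0 : ∀ᶠ x in 𝓝[>] 0, 0 < f x)
    (hstep : ∀ t, 0 < t → (∀ x ∈ Ioo 0 t, 0 < f x) → 0 < f t) {x : ℝ} (hx : 0 < x) : 0 < f x := by
  obtain ⟨δ, hδ : 0 < δ, hδpos⟩ := mem_nhdsGT_iff_exists_Ioo_subset.1 h0
  by_contra! hneg
  have hδx : δ ≤ x := not_lt.1 fun h => hneg.not_gt (hδpos ⟨hx, h⟩)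
  have hcompact : IsCompact (Icc (δ / 2) x ∩ f ⁻¹' Iic 0) :=
    isCompact_Icc.of_isClosed_subset
      ((hf.mono fun y hy => (half_pos hδ).trans_le hy.1).preimage_isClosed_of_isClosed
        isClosed_Icc isClosed_Iic) inter_subset_left
  obtain ⟨t, htS, htmin⟩ := hcompact.exists_isLeast ⟨x, ⟨by linarith, le_rfl⟩, hneg⟩
  have ht0 : 0 < t := (half_pos hδ).trans_le htS.1.1
  refine (hstep t ht0 fun y hy => ?_).not_ge htS.2
  rcases lt_or_ge y δ with h | h
  · exact hδpos ⟨hy.1, h⟩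
  · by_contra! hle
    exact (htmin ⟨⟨by linarith, hy.2.le.trans htS.1.2⟩, hle⟩).not_gt hy.2

theorem fracKernel_pos {α c x : ℝ} (hα0 : 0 < α) (hα1 : α ≤ 1) (hx : 0 < x) :
    0 < fracKernel α α c x := by
  rcases le_or_gt c 0 with hc | hc
  · exact pos_of_eventually_pos_of_pos_on_Ioo (continuousOn_fracKernel hα0 hα0)
      (eventually_fracKernel_pos hα0) (fun t => fracKernel_pos_of_pos_on_Ioo hα0 hα1 hc) hx
  · have hterm (k : ℕ) : 0 < (Real.Gamma (α * k + α))⁻¹ * c ^ k * x ^ (α * k + α - 1) := by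
      have := Real.Gamma_pos_of_pos (show 0 < α * k + α by positivity)
      positivity
    have h := hasSum_fracKernel c hα0 hα0 hx
    rw [← h.tsum_eq]
    exact h.summable.tsum_pos (fun k => (hterm k).le) 0 (hterm 0)

theorem measurable_barrierR0 {α μ : ℝ} : Measurable (barrierR0 α μ) := by
  unfold barrierR0
  fun_prop

theorem barrierR0_sub_mul {α μ x y z : ℝ} :
    barrierR0 α μ (x - y) * z =
      (Real.Gamma (1 - α))⁻¹ * ((x - y) ^ (1 - α - 1) * z) + μ * ((x - y) ^ ((1 : ℝ) - 1) * z) := by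
  rw [barrierR0, sub_self, Real.rpow_zero, sub_sub_cancel_left]
  ring

theorem intervalIntegrable_barrierR0_mul_fracKernel {α μ x : ℝ} (hα0 : 0 < α) (hα1 : α < 1)
    (hx : 0 < x) :
    IntervalIntegrable (fun y => barrierR0 α μ (x - y) * fracKernel α α (-μ) y) volume 0 x := by
  simp_rw [barrierR0_sub_mul]
  exact ((intervalIntegrable_sub_rpow_mul_fracKernel hα0 hα0 (sub_pos.2 hα1) hx).const_mul _).add
    ((intervalIntegrable_sub_rpow_mul_fracKernel hα0 hα0 one_pos hx).const_mul μ)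

theorem integral_barrierR0_mul_fracKernel {α μ x : ℝ} (hα0 : 0 < α) (hα1 : α < 1) (hx : 0 < x) :
    ∫ y in 0..x, barrierR0 α μ (x - y) * fracKernel α α (-μ) y = 1 := by
  have hβ : 0 < 1 - α := sub_pos.2 hα1
  simp_rw [barrierR0_sub_mul]
  rw [intervalIntegral.integral_add
      ((intervalIntegrable_sub_rpow_mul_fracKernel hα0 hα0 hβ hx).const_mul _)
      ((intervalIntegrable_sub_rpow_mul_fracKernel hα0 hα0 one_pos hx).const_mul μ),
    intervalIntegral.integral_const_mul, intervalIntegral.integral_const_mul,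
    integral_sub_rpow_mul_fracKernel hα0 hα0 hβ hx,
    integral_sub_rpow_mul_fracKernel hα0 hα0 one_pos hx, sub_add_cancel,
    inv_mul_cancel_left₀ (Real.Gamma_pos_of_pos hβ).ne', fracKernel_eq_add hα0 one_pos hx,
    add_comm α 1]
  simp

theorem intervalIntegrable_fracKernel_sub {α c r t : ℝ} (hα : 0 < α) (hrt : r < t) :
    IntervalIntegrable (fun s => fracKernel α α c (t - s)) volume r t := by
  simpa using ((intervalIntegrable_fracKernel (c := c) hα hα (sub_pos.2 hrt)).comp_sub_left t).symm

theorem intervalIntegrable_fracKernel_mul_barrierR0 {α μ r t : ℝ} (hα0 : 0 < α) (hα1 : α < 1)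
    (hrt : r < t) :
    IntervalIntegrable (fun s => fracKernel α α (-μ) (t - s) * barrierR0 α μ (s - r))
      volume r t := by
  have h := ((intervalIntegrable_barrierR0_mul_fracKernel (μ := μ) hα0 hα1
    (sub_pos.2 hrt)).comp_sub_left t).symm
  simpa only [sub_zero, sub_sub_cancel, sub_sub_sub_cancel_left, mul_comm] using h

theorem integral_fracKernel_mul_barrierR0 {α μ r t : ℝ} (hα0 : 0 < α) (hα1 : α < 1) (hrt : r < t) :
    ∫ s in r..t, fracKernel α α (-μ) (t - s) * barrierR0 α μ (s - r) = 1 := by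
  have h := intervalIntegral.integral_comp_sub_left (a := r) (b := t)
    (fun y => barrierR0 α μ (t - r - y) * fracKernel α α (-μ) y) t
  rw [sub_self, integral_barrierR0_mul_fracKernel hα0 hα1 (sub_pos.2 hrt)] at h
  simpa only [sub_sub_sub_cancel_left, mul_comm] using h

theorem abs_barrierR0_le {α μ x : ℝ} (hα : α < 1) (hx : 0 ≤ x) :
    |barrierR0 α μ x| ≤ barrierR0 α μ x + 2 * |μ| := by
  have := Real.Gamma_pos_of_pos (sub_pos.2 hα)
  have h : 0 ≤ (Real.Gamma (1 - α))⁻¹ * x ^ (-α) := by positivity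
  rw [barrierR0, abs_le]
  constructor <;> linarith [neg_abs_le μ, abs_nonneg μ]

theorem integral_abs_fracKernel_mul_barrierR0_le {α μ a r t : ℝ} (hα0 : 0 < α) (hα1 : α < 1)
    (har : a ≤ r) (hrt : r < t) :
    ∫ s in r..t, |fracKernel α α (-μ) (t - s) * barrierR0 α μ (s - r)| ≤
      1 + 2 * |μ| * ∫ s in a..t, fracKernel α α (-μ) (t - s) := by
  have hk := intervalIntegrable_fracKernel_sub (c := -μ) hα0 (har.trans_lt hrt)
  have hkr := intervalIntegrable_fracKernel_sub (c := -μ) hα0 hrt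
  have hkR := intervalIntegrable_fracKernel_mul_barrierR0 (μ := μ) hα0 hα1 hrt
  calc ∫ s in r..t, |fracKernel α α (-μ) (t - s) * barrierR0 α μ (s - r)|
      ≤ ∫ s in r..t, (fracKernel α α (-μ) (t - s) * barrierR0 α μ (s - r) +
          2 * |μ| * fracKernel α α (-μ) (t - s)) := by
        refine intervalIntegral.integral_mono_on_of_le_Ioo hrt.le hkR.abs
          (hkR.add (hkr.const_mul _)) fun s hs => ?_
        have hpos := fracKernel_pos (c := -μ) hα0 hα1.le (sub_pos.2 hs.2)
        rw [abs_mul, abs_of_pos hpos]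
        nlinarith [abs_barrierR0_le (μ := μ) hα1 (sub_nonneg.2 hs.1.le)]
    _ = 1 + 2 * |μ| * ∫ s in r..t, fracKernel α α (-μ) (t - s) := by
        rw [intervalIntegral.integral_add hkR (hkr.const_mul _),
          integral_fracKernel_mul_barrierR0 hα0 hα1 hrt, intervalIntegral.integral_const_mul]
    _ ≤ _ := by
        gcongr
        refine intervalIntegral.integral_mono_interval har hrt.le le_rfl ?_ hk
        rw [← restrict_Ioo_eq_restrict_Ioc]
        filter_upwards [ae_restrict_mem measurableSet_Ioo] with s hs
        exact (fracKernel_pos hα0 hα1.le (sub_pos.2 hs.2)).le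

/-! ### Fubini's theorem on a triangle -/

theorem integrable_prod_mul_snd {X Y : Type*} [MeasurableSpace X] [MeasurableSpace Y]
    {ν : Measure X} {ν' : Measure Y} [SFinite ν] [SFinite ν'] {K : X × Y → ℝ} {g : Y → ℝ} {M : ℝ}
    (hK : AEStronglyMeasurable K (ν.prod ν')) (hg : Integrable g ν')
    (hKint : ∀ᵐ y ∂ν', Integrable (fun x => K (x, y)) ν)
    (hKM : ∀ᵐ y ∂ν', ∫ x, ‖K (x, y)‖ ∂ν ≤ M) :
    Integrable (fun p : X × Y => K p * g p.2) (ν.prod ν') := by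
  have hm : AEStronglyMeasurable (fun p : X × Y => K p * g p.2) (ν.prod ν') :=
    hK.mul hg.aestronglyMeasurable.comp_snd
  rw [integrable_prod_iff' hm]
  refine ⟨hKint.mono fun y hy => hy.mul_const (g y), (hg.norm.const_mul M).mono'
    hm.norm.prod_swap.integral_prod_right' (hKM.mono fun y hy => ?_)⟩
  simp_rw [norm_mul, integral_mul_const, norm_mul, norm_norm]
  rw [Real.norm_of_nonneg (integral_nonneg fun _ => norm_nonneg _)]
  gcongr

theorem setIntegral_Ioc_indicator_Ioi {f : ℝ → ℝ} {a r t : ℝ} (hr : r ∈ Icc a t) :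
    ∫ s in Ioc a t, (Ioi r).indicator f s = ∫ s in r..t, f s := by
  rw [setIntegral_indicator measurableSet_Ioi, Ioc_inter_Ioi, max_eq_right hr.1,
    intervalIntegral.integral_of_le hr.2]

theorem setIntegral_Ioc_indicator_Iio {f : ℝ → ℝ} {a s t : ℝ} (hs : s ∈ Icc a t) :
    ∫ r in Ioc a t, (Iio s).indicator f r = ∫ r in a..s, f r := by
  rw [setIntegral_indicator measurableSet_Iio, intervalIntegral.integral_of_le hs.1,
    integral_Ioc_eq_integral_Ioo]
  congr 2
  ext r
  exact ⟨fun h => ⟨h.1.1, h.2⟩, fun h => ⟨⟨h.1, h.2.le.trans hs.2⟩, h.2⟩⟩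

section Triangle

variable {K : ℝ → ℝ → ℝ} {g : ℝ → ℝ} {a t M : ℝ}

theorem ae_restrict_Ioc_mem_Ioo : ∀ᵐ r ∂volume.restrict (Ioc a t), r ∈ Ioo a t := by
  rw [← restrict_Ioo_eq_restrict_Ioc]
  exact ae_restrict_mem measurableSet_Ioo

theorem integrable_triangle_mul (hK : Measurable (Function.uncurry K))
    (hg : IntegrableOn g (Ioc a t))
    (hKint : ∀ r ∈ Ioo a t, IntervalIntegrable (fun s => K s r) volume r t)
    (hKM : ∀ r ∈ Ioo a t, ∫ s in r..t, |K s r| ≤ M) :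
    Integrable (fun p : ℝ × ℝ => (Ioi p.2).indicator (fun s => K s p.2) p.1 * g p.2)
      ((volume.restrict (Ioc a t)).prod (volume.restrict (Ioc a t))) := by
  refine integrable_prod_mul_snd (K := fun p => (Ioi p.2).indicator (fun s => K s p.2) p.1)
    (M := M) ?_ hg ?_ ?_
  · exact (hK.indicator (measurableSet_lt measurable_snd measurable_fst)).aestronglyMeasurable
  · filter_upwards [ae_restrict_Ioc_mem_Ioo] with r hr
    rw [integrable_indicator_iff measurableSet_Ioi, IntegrableOn,
      Measure.restrict_restrict measurableSet_Ioi, inter_comm, Ioc_inter_Ioi, max_eq_right hr.1.le]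
    exact (hKint r hr).1
  · filter_upwards [ae_restrict_Ioc_mem_Ioo] with r hr
    simp_rw [norm_indicator_eq_indicator_norm]
    rw [setIntegral_Ioc_indicator_Ioi (Ioo_subset_Icc_self hr)]
    exact hKM r hr

theorem setIntegral_triangle_mul {s : ℝ} (hs : s ∈ Ioc a t) :
    ∫ r in Ioc a t, (Ioi r).indicator (fun s => K s r) s * g r = ∫ r in a..s, K s r * g r := by
  rw [← setIntegral_Ioc_indicator_Iio (Ioc_subset_Icc_self hs)]
  congr 1 with r
  simp only [indicator, mem_Ioi, mem_Iio]
  split_ifs <;> simp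

theorem intervalIntegrable_integral_mul_of_triangle (hat : a ≤ t)
    (hK : Measurable (Function.uncurry K)) (hg : IntervalIntegrable g volume a t)
    (hKint : ∀ r ∈ Ioo a t, IntervalIntegrable (fun s => K s r) volume r t)
    (hKM : ∀ r ∈ Ioo a t, ∫ s in r..t, |K s r| ≤ M) :
    IntervalIntegrable (fun s => ∫ r in a..s, K s r * g r) volume a t := by
  rw [intervalIntegrable_iff_integrableOn_Ioc_of_le hat]
  exact IntegrableOn.congr_fun (integrable_triangle_mul hK hg.1 hKint hKM).integral_prod_left
    (fun s hs => setIntegral_triangle_mul hs) measurableSet_Ioc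

theorem integral_integral_triangle_swap_mul (hat : a ≤ t)
    (hK : Measurable (Function.uncurry K)) (hg : IntervalIntegrable g volume a t)
    (hKint : ∀ r ∈ Ioo a t, IntervalIntegrable (fun s => K s r) volume r t)
    (hKM : ∀ r ∈ Ioo a t, ∫ s in r..t, |K s r| ≤ M) :
    ∫ s in a..t, ∫ r in a..s, K s r * g r = ∫ r in a..t, (∫ s in r..t, K s r) * g r := by
  rw [intervalIntegral.integral_of_le hat, intervalIntegral.integral_of_le hat,
    ← setIntegral_congr_fun measurableSet_Ioc fun s hs => setIntegral_triangle_mul hs,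
    integral_integral_swap (integrable_triangle_mul hK hg.1 hKint hKM)]
  refine setIntegral_congr_fun measurableSet_Ioc fun r hr => ?_
  rw [integral_mul_const, setIntegral_Ioc_indicator_Ioi (Ioc_subset_Icc_self hr)]

end Triangle

/-! ### The truncated operator -/

/-- `Γ(1-α)⁻¹ ((s-a)^{-α} v(a) + ∫_a^s (s-r)^{-α} g(r) dr) + μ v(s)` for `v' = g` on `[a, s]`:
the operator `D_t^α + μ` applied to `v` after `v` has been replaced by `0` on `[0, a)`. -/
noncomputable def truncatedOp {X : Type*} [NormedAddCommGroup X] [NormedSpace ℝ X] (α μ : ℝ)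
    (v g : ℝ → X) (a s : ℝ) : X :=
  barrierR0 α μ (s - a) • v a + ∫ r in a..s, barrierR0 α μ (s - r) • g r

section Inversion

variable {α μ a t : ℝ}

theorem measurable_fracKernel_mul_barrierR0 (hα : 0 < α) :
    Measurable (Function.uncurry fun s r =>
      fracKernel α α (-μ) (t - s) * barrierR0 α μ (s - r)) :=
  ((measurable_fracKernel hα hα).comp (measurable_const.sub measurable_fst)).mul
    (measurable_barrierR0.comp (measurable_fst.sub measurable_snd))

theorem intervalIntegrable_fracKernel_mul_integral_barrierR0 {g : ℝ → ℝ} (hα0 : 0 < α)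
    (hα1 : α < 1) (hat : a ≤ t) (hg : IntervalIntegrable g volume a t) :
    IntervalIntegrable (fun s =>
      fracKernel α α (-μ) (t - s) * ∫ r in a..s, barrierR0 α μ (s - r) * g r) volume a t := by
  simp_rw [← intervalIntegral.integral_const_mul, ← mul_assoc]
  exact intervalIntegrable_integral_mul_of_triangle hat (measurable_fracKernel_mul_barrierR0 hα0) hg
    (fun r hr => intervalIntegrable_fracKernel_mul_barrierR0 hα0 hα1 hr.2)
    fun r hr => integral_abs_fracKernel_mul_barrierR0_le hα0 hα1 hr.1.le hr.2

theorem integral_fracKernel_mul_integral_barrierR0 {g : ℝ → ℝ} (hα0 : 0 < α)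
    (hα1 : α < 1) (hat : a ≤ t) (hg : IntervalIntegrable g volume a t) :
    ∫ s in a..t, fracKernel α α (-μ) (t - s) * ∫ r in a..s, barrierR0 α μ (s - r) * g r =
      ∫ r in a..t, g r := by
  simp_rw [← intervalIntegral.integral_const_mul, ← mul_assoc]
  rw [integral_integral_triangle_swap_mul hat (measurable_fracKernel_mul_barrierR0 hα0) hg
    (fun r hr => intervalIntegrable_fracKernel_mul_barrierR0 hα0 hα1 hr.2)
    fun r hr => integral_abs_fracKernel_mul_barrierR0_le hα0 hα1 hr.1.le hr.2,
    intervalIntegral.integral_of_le hat, intervalIntegral.integral_of_le hat]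
  refine integral_congr_ae (ae_restrict_Ioc_mem_Ioo.mono fun r hr => ?_)
  simp only [integral_fracKernel_mul_barrierR0 hα0 hα1 hr.2, one_mul]

theorem fracKernel_mul_truncatedOp {v g : ℝ → ℝ} {s : ℝ} :
    fracKernel α α (-μ) (t - s) * truncatedOp α μ v g a s =
      fracKernel α α (-μ) (t - s) * barrierR0 α μ (s - a) * v a +
        fracKernel α α (-μ) (t - s) * ∫ r in a..s, barrierR0 α μ (s - r) * g r := by
  simp only [truncatedOp, smul_eq_mul]
  ring

theorem intervalIntegrable_fracKernel_mul_truncatedOp {v g : ℝ → ℝ} (hα0 : 0 < α)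
    (hα1 : α < 1) (hat : a < t) (hg : IntervalIntegrable g volume a t) :
    IntervalIntegrable (fun s => fracKernel α α (-μ) (t - s) * truncatedOp α μ v g a s)
      volume a t := by
  simp_rw [fracKernel_mul_truncatedOp]
  exact ((intervalIntegrable_fracKernel_mul_barrierR0 hα0 hα1 hat).mul_const _).add
    (intervalIntegrable_fracKernel_mul_integral_barrierR0 hα0 hα1 hat.le hg)

theorem integral_fracKernel_mul_truncatedOp {v g : ℝ → ℝ} (hα0 : 0 < α) (hα1 : α < 1)
    (hat : a < t) (hv : HasTimeDeriv v g a t) :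
    ∫ s in a..t, fracKernel α α (-μ) (t - s) * truncatedOp α μ v g a s = v t := by
  simp_rw [fracKernel_mul_truncatedOp]
  rw [intervalIntegral.integral_add
      ((intervalIntegrable_fracKernel_mul_barrierR0 hα0 hα1 hat).mul_const _)
      (intervalIntegrable_fracKernel_mul_integral_barrierR0 hα0 hα1 hat.le hv.1),
    intervalIntegral.integral_mul_const, integral_fracKernel_mul_barrierR0 hα0 hα1 hat, one_mul,
    integral_fracKernel_mul_integral_barrierR0 hα0 hα1 hat.le hv.1, hv.2 t (right_mem_Icc.2 hat.le)]

theorem intervalIntegrable_fracKernel_mul_barrierR0_sub (hα0 : 0 < α) (hα1 : α < 1)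
    (ha : 0 ≤ a) (hat : a < t) :
    IntervalIntegrable (fun s =>
      fracKernel α α (-μ) (t - s) * (barrierR0 α μ (s - a) - barrierR0 α μ s)) volume a t := by
  have h := intervalIntegrable_fracKernel_mul_barrierR0 (μ := μ) hα0 hα1 (ha.trans_lt hat)
  simp only [sub_zero] at h
  simp_rw [mul_sub]
  refine (intervalIntegrable_fracKernel_mul_barrierR0 hα0 hα1 hat).sub (h.mono_set ?_)
  exact uIcc_subset_uIcc_right (mem_uIcc_of_le ha hat.le)

theorem integral_fracKernel_mul_barrierR0_sub (hα0 : 0 < α) (hα1 : α < 1) (ha : 0 ≤ a)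
    (hat : a < t) :
    ∫ s in a..t, fracKernel α α (-μ) (t - s) * (barrierR0 α μ (s - a) - barrierR0 α μ s) =
      ∫ s in 0..a, fracKernel α α (-μ) (t - s) * barrierR0 α μ s := by
  have h := intervalIntegrable_fracKernel_mul_barrierR0 (μ := μ) hα0 hα1 (ha.trans_lt hat)
  have h1 := integral_fracKernel_mul_barrierR0 (μ := μ) hα0 hα1 (ha.trans_lt hat)
  simp only [sub_zero] at h h1
  have ha_mem : a ∈ uIcc 0 t := mem_uIcc_of_le ha hat.le
  have h0a := h.mono_set (uIcc_subset_uIcc_left ha_mem)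
  have h_at := h.mono_set (uIcc_subset_uIcc_right ha_mem)
  simp_rw [mul_sub]
  rw [intervalIntegral.integral_sub (intervalIntegrable_fracKernel_mul_barrierR0 hα0 hα1 hat) h_at,
    integral_fracKernel_mul_barrierR0 hα0 hα1 hat, sub_eq_iff_eq_add,
    intervalIntegral.integral_add_adjacent_intervals h0a h_at, h1]

theorem tendsto_integral_fracKernel_mul_barrierR0_sub (hα0 : 0 < α) (hα1 : α < 1) (ht : 0 < t) :
    Tendsto (fun a => ∫ s in a..t,
        fracKernel α α (-μ) (t - s) * (barrierR0 α μ (s - a) - barrierR0 α μ s))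
      (𝓝[>] 0) (𝓝 0) := by
  have h := intervalIntegrable_fracKernel_mul_barrierR0 (μ := μ) hα0 hα1 ht
  simp only [sub_zero] at h
  have hcont := intervalIntegral.continuousOn_primitive_interval' h left_mem_uIcc 0 left_mem_uIcc
  rw [ContinuousWithinAt, intervalIntegral.integral_same, uIcc_of_le ht.le] at hcont
  refine (hcont.mono_left ?_).congr' ?_
  · rw [← nhdsWithin_Ioo_eq_nhdsGT ht]
    exact nhdsWithin_mono _ Ioo_subset_Icc_self
  · filter_upwards [Ioo_mem_nhdsGT ht] with a ha
    rw [integral_fracKernel_mul_barrierR0_sub hα0 hα1 ha.1.le ha.2]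

end Inversion

section Regularity

variable {X : Type*} [NormedAddCommGroup X] [NormedSpace ℝ X] {v w g h : ℝ → X} {a b : ℝ}

theorem HasTimeDeriv.mono {c d : ℝ} (hv : HasTimeDeriv v g a b) (hac : a ≤ c) (hcd : c ≤ d)
    (hdb : d ≤ b) : HasTimeDeriv v g c d := by
  have hsub {x y : ℝ} (hax : a ≤ x) (hxy : x ≤ y) (hyb : y ≤ b) :
      IntervalIntegrable g volume x y :=
    hv.1.mono_set (uIcc_subset_uIcc (mem_uIcc_of_le hax (hxy.trans hyb))
      (mem_uIcc_of_le (hax.trans hxy) hyb))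
  refine ⟨hsub hac hcd hdb, fun s hs => ?_⟩
  rw [hv.2 s ⟨hac.trans hs.1, hs.2.trans hdb⟩, hv.2 c ⟨hac, hcd.trans hdb⟩, add_assoc,
    intervalIntegral.integral_add_adjacent_intervals (hsub le_rfl hac (hcd.trans hdb))
      (hsub hac hs.1 (hs.2.trans hdb))]

theorem HasTimeDeriv.continuousOn (hv : HasTimeDeriv v g a b) (hab : a ≤ b) :
    ContinuousOn v (Icc a b) := by
  have h := intervalIntegral.continuousOn_primitive_interval' hv.1 left_mem_uIcc
  rw [uIcc_of_le hab] at h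
  exact (continuousOn_const.add h).congr hv.2

theorem HasTimeDeriv.sub (hv : HasTimeDeriv v g a b) (hw : HasTimeDeriv w h a b) :
    HasTimeDeriv (fun s => v s - w s) (fun s => g s - h s) a b := by
  refine ⟨hv.1.sub hw.1, fun s hs => ?_⟩
  have hsub : uIcc a s ⊆ uIcc a b := uIcc_subset_uIcc_left (mem_uIcc_of_le hs.1 hs.2)
  beta_reduce
  rw [hv.2 s hs, hw.2 s hs,
    intervalIntegral.integral_sub (hv.1.mono_set hsub) (hw.1.mono_set hsub)]
  abel

theorem HasTimeDeriv.clm_comp [CompleteSpace X] (hv : HasTimeDeriv v g a b) (L : X →L[ℝ] ℝ) :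
    HasTimeDeriv (fun s => L (v s)) (fun s => L (g s)) a b := by
  refine ⟨⟨L.integrable_comp hv.1.1, L.integrable_comp hv.1.2⟩, fun s hs => ?_⟩
  have hsub : uIcc a s ⊆ uIcc a b := uIcc_subset_uIcc_left (mem_uIcc_of_le hs.1 hs.2)
  beta_reduce
  rw [hv.2 s hs, map_add, L.intervalIntegral_comp_comm (hv.1.mono_set hsub)]

theorem HasTimeDeriv.ae_hasDerivAt [CompleteSpace X] (hv : HasTimeDeriv v g a b) :
    ∀ᵐ r ∂volume.restrict (Ioc a b), HasDerivAt v (g r) r := by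
  filter_upwards [ae_restrict_of_ae hv.1.ae_hasDerivAt_integral, ae_restrict_Ioc_mem_Ioo]
    with r hr hrab
  have hmem : r ∈ uIcc a b := mem_uIcc_of_le hrab.1.le hrab.2.le
  refine ((hr hmem a left_mem_uIcc).const_add (v a)).congr_of_eventuallyEq ?_
  filter_upwards [Ioo_mem_nhds hrab.1 hrab.2] with x hx
  exact hv.2 x (Ioo_subset_Icc_self hx)

theorem truncatedOp_deriv [CompleteSpace X] {α μ : ℝ} (hv : HasTimeDeriv v g a b) (hab : a ≤ b) :
    truncatedOp α μ v (deriv v) a b = truncatedOp α μ v g a b := by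
  rw [truncatedOp, truncatedOp, intervalIntegral.integral_of_le hab,
    intervalIntegral.integral_of_le hab]
  congr 1
  exact integral_congr_ae (hv.ae_hasDerivAt.mono fun r hr => congrArg _ hr.deriv)

theorem barrierR0_eq_add {α μ x : ℝ} : barrierR0 α μ x = barrierR0 α 0 x + μ := by
  rw [barrierR0, barrierR0, add_zero]

theorem truncatedOp_eq_add {α μ s : ℝ} (has : a ≤ s) (hv : HasTimeDeriv v g a s)
    (hRg : IntervalIntegrable (fun r => barrierR0 α 0 (s - r) • g r) volume a s) :
    truncatedOp α μ v g a s = truncatedOp α 0 v g a s + μ • v s := by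
  have hμg : IntervalIntegrable (fun r => μ • g r) volume a s := hv.1.smul μ
  simp_rw [truncatedOp, barrierR0_eq_add (μ := μ), add_smul]
  rw [intervalIntegral.integral_add hRg hμg, intervalIntegral.integral_smul,
    hv.2 s (right_mem_Icc.2 has), smul_add]
  abel

theorem HasCaputoDerivAt.exists_tendsto_truncatedOp {α t : ℝ} {w : X}
    (hv : HasCaputoDerivAt α v t w) :
    ∃ g : ℝ → X,
      (∀ ε ∈ Ioo 0 t, HasTimeDeriv v g ε t ∧
        IntervalIntegrable (fun s => barrierR0 α 0 (t - s) • g s) volume ε t) ∧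
      Tendsto (fun ε => truncatedOp α 0 v g ε t - (barrierR0 α 0 (t - ε) - barrierR0 α 0 t) • v ε -
        barrierR0 α 0 t • v 0) (𝓝[>] 0) (𝓝 w) := by
  obtain ⟨g, hg, hlim⟩ := hv
  have hR0 (x : ℝ) : barrierR0 α 0 x = (Real.Gamma (1 - α))⁻¹ * x ^ (-α) := by
    rw [barrierR0, add_zero]
  refine ⟨g, fun ε hε => ⟨(hg ε hε).1, ?_⟩, hlim.congr fun ε => ?_⟩
  · simp_rw [hR0, mul_smul]
    exact (hg ε hε).2.smul (Real.Gamma (1 - α))⁻¹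
  · simp_rw [truncatedOp, hR0, mul_smul, intervalIntegral.integral_smul]
    module

end Regularity

theorem hasTimeDeriv_deriv_of_lipschitzOnWith {v : ℝ → ℝ} {C : NNReal} {a b : ℝ}
    (hv : LipschitzOnWith C v (Icc a b)) (hab : a ≤ b) : HasTimeDeriv v (deriv v) a b := by
  have hac (s : ℝ) (hs : s ∈ Icc a b) : AbsolutelyContinuousOnInterval v a s := by
    refine LipschitzOnWith.absolutelyContinuousOnInterval (K := C) ?_
    rw [uIcc_of_le hs.1]
    exact hv.mono (Icc_subset_Icc_right hs.2)
  refine ⟨(hac b (right_mem_Icc.2 hab)).intervalIntegrable_deriv, fun s hs => ?_⟩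
  rw [(hac s hs).integral_deriv_eq_sub, add_sub_cancel]

theorem hasTimeDeriv_of_hasDerivAt {v g : ℝ → ℝ} {a b : ℝ} (hab : a ≤ b)
    (hv : ∀ r ∈ Icc a b, HasDerivAt v (g r) r) (hg : IntervalIntegrable g volume a b) :
    HasTimeDeriv v g a b := by
  refine ⟨hg, fun s hs => ?_⟩
  have hsub : uIcc a s ⊆ uIcc a b := uIcc_subset_uIcc_left (mem_uIcc_of_le hs.1 hs.2)
  rw [intervalIntegral.integral_eq_sub_of_hasDerivAt
    (fun r hr => hv r (uIcc_of_le hab ▸ hsub hr)) (hg.mono_set hsub), add_sub_cancel]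

theorem HasTimeDeriv.absolutelyContinuousOnInterval {v g : ℝ → ℝ} {a b : ℝ}
    (hv : HasTimeDeriv v g a b) (hab : a ≤ b) : AbsolutelyContinuousOnInterval v a b := by
  have hprim : AbsolutelyContinuousOnInterval (fun s => v a + ∫ r in a..s, g r) a b :=
    (LipschitzWith.const (v a)).lipschitzOnWith.absolutelyContinuousOnInterval.fun_add
      (hv.1.absolutelyContinuousOnInterval_intervalIntegral left_mem_uIcc)
  refine Tendsto.congr' ?_ hprim
  filter_upwards [mem_inf_of_right (mem_principal_self _)] with E hE
  refine Finset.sum_congr rfl fun i hi => ?_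
  obtain ⟨h1, h2⟩ := hE.1 i hi
  rw [uIcc_of_le hab] at h1 h2
  rw [hv.2 _ h1, hv.2 _ h2]

theorem HasTimeDeriv.integral_mul {w w' v g : ℝ → ℝ} {a b : ℝ} (hw : HasTimeDeriv w w' a b)
    (hv : HasTimeDeriv v g a b) (hab : a ≤ b) :
    ∫ r in a..b, w r * g r = w b * v b - w a * v a - ∫ r in a..b, w' r * v r := by
  have h := (hw.absolutelyContinuousOnInterval hab).integral_mul_deriv_eq_deriv_mul
    (hv.absolutelyContinuousOnInterval hab)
  have hderiv {u u' z : ℝ → ℝ} (hu : HasTimeDeriv u u' a b) :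
      ∫ r in a..b, z r * deriv u r = ∫ r in a..b, z r * u' r := by
    rw [intervalIntegral.integral_of_le hab, intervalIntegral.integral_of_le hab]
    exact integral_congr_ae (hu.ae_hasDerivAt.mono fun r hr => congrArg _ hr.deriv)
  simp_rw [mul_comm _ (v _)] at h ⊢
  rwa [hderiv hv, hderiv hw] at h

theorem hasTimeDeriv_barrierR0_sub {α μ a b s : ℝ} (hab : a ≤ b) (hbs : b < s) :
    HasTimeDeriv (fun r => barrierR0 α μ (s - r))
      (fun r => (Real.Gamma (1 - α))⁻¹ * (α * (s - r) ^ (-α - 1))) a b := by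
  have hne : ∀ r ∈ Icc a b, s - r ≠ 0 := fun r hr => (sub_pos.2 (hr.2.trans_lt hbs)).ne'
  refine hasTimeDeriv_of_hasDerivAt hab (fun r hr => ?_) (ContinuousOn.intervalIntegrable ?_)
  · have h := ((hasDerivAt_id r).const_sub s).rpow_const (p := -α) (Or.inl (hne r hr))
    simpa [barrierR0] using (h.const_mul (Real.Gamma (1 - α))⁻¹).add_const μ
  · rw [uIcc_of_le hab]
    exact continuousOn_const.mul (continuousOn_const.mul
      ((continuousOn_const.sub continuousOn_id).rpow_const fun r hr => Or.inl (hne r hr)))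

section Truncation

variable {α μ η ε s C : ℝ} {v g : ℝ → ℝ}

theorem truncatedOp_eq_sub_integral (hηε : η ≤ ε) (hεs : ε < s) (hv : HasTimeDeriv v g η s)
    (hRg : IntervalIntegrable (fun r => barrierR0 α μ (s - r) * g r) volume η s) :
    truncatedOp α μ v g η s = truncatedOp α μ v g ε s -
      ∫ r in η..ε, (Real.Gamma (1 - α))⁻¹ * (α * (s - r) ^ (-α - 1)) * v r := by
  have hmem : ε ∈ uIcc η s := mem_uIcc_of_le hηε hεs.le
  have hibp := (hasTimeDeriv_barrierR0_sub (α := α) (μ := μ) hηε hεs).integral_mul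
    (hv.mono le_rfl hηε hεs.le) hηε
  simp only [truncatedOp, smul_eq_mul]
  rw [← intervalIntegral.integral_add_adjacent_intervals
    (hRg.mono_set (uIcc_subset_uIcc_left hmem)) (hRg.mono_set (uIcc_subset_uIcc_right hmem)), hibp]
  ring

theorem truncatedOp_anti (hα0 : 0 < α) (hα1 : α < 1) (hηε : η ≤ ε) (hεs : ε < s)
    (hv : HasTimeDeriv v g η s) (hv0 : ∀ r ∈ Icc η ε, 0 ≤ v r)
    (hRg : IntervalIntegrable (fun r => barrierR0 α μ (s - r) * g r) volume η s) :
    truncatedOp α μ v g η s ≤ truncatedOp α μ v g ε s := by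
  rw [truncatedOp_eq_sub_integral hηε hεs hv hRg, sub_le_self_iff]
  have := Real.Gamma_pos_of_pos (sub_pos.2 hα1)
  refine intervalIntegral.integral_nonneg hηε fun r hr => mul_nonneg ?_ (hv0 r hr)
  have : 0 < s - r := sub_pos.2 (hr.2.trans_lt hεs)
  positivity

theorem truncatedOp_le_add (hα0 : 0 < α) (hα1 : α < 1) (hηε : η ≤ ε) (hεs : ε < s)
    (hv : HasTimeDeriv v g η s) (hvC : ∀ r ∈ Icc η ε, v r ≤ C)
    (hRg : IntervalIntegrable (fun r => barrierR0 α μ (s - r) * g r) volume η s) :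
    truncatedOp α μ v g ε s ≤
      truncatedOp α μ v g η s + C * (barrierR0 α μ (s - ε) - barrierR0 α μ (s - η)) := by
  have hR := hasTimeDeriv_barrierR0_sub (α := α) (μ := μ) hηε hεs
  have hvcont := (hv.mono le_rfl hηε hεs.le).continuousOn hηε
  rw [← uIcc_of_le hηε] at hvcont
  have hRε := hR.2 ε (right_mem_Icc.2 hηε)
  beta_reduce at hRε
  rw [truncatedOp_eq_sub_integral hηε hεs hv hRg, hRε,
    add_sub_cancel_left, ← intervalIntegral.integral_const_mul, sub_add, le_sub_self_iff,
    sub_nonpos]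
  refine intervalIntegral.integral_mono_on hηε (hR.1.mul_continuousOn hvcont) (hR.1.const_mul C)
    fun r hr => ?_
  have : 0 < s - r := sub_pos.2 (hr.2.trans_lt hεs)
  have := Real.Gamma_pos_of_pos (sub_pos.2 hα1)
  rw [mul_comm C]
  exact mul_le_mul_of_nonneg_left (hvC r hr) (by positivity)

theorem barrierR0_zero_nonneg {x : ℝ} (hα : α < 1) (hx : 0 ≤ x) : 0 ≤ barrierR0 α 0 x := by
  have := Real.Gamma_pos_of_pos (sub_pos.2 hα)
  rw [barrierR0]
  positivity

theorem barrierR0_antitoneOn (hα0 : 0 ≤ α) (hα1 : α < 1) : AntitoneOn (barrierR0 α μ) (Ioi 0) := by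
  intro x hx y _ hxy
  have := Real.Gamma_pos_of_pos (sub_pos.2 hα1)
  have := Real.rpow_le_rpow_of_nonpos hx hxy (neg_nonpos.2 hα0)
  rw [barrierR0, barrierR0]
  gcongr

theorem truncatedOp_zero_le_integral_abs (hα0 : 0 ≤ α) (hα1 : α < 1) (hεs : ε < s)
    (hv : HasTimeDeriv v g ε s) (hvs : v s = 0)
    (hRg : IntervalIntegrable (fun r => barrierR0 α 0 (s - r) * g r) volume ε s) :
    truncatedOp α 0 v g ε s ≤ ∫ r in ε..s, |barrierR0 α 0 (s - r) * g r| := by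
  have hvε : v ε = -∫ r in ε..s, g r :=
    eq_neg_of_add_eq_zero_left ((hv.2 s (right_mem_Icc.2 hεs.le)).symm.trans hvs)
  simp only [truncatedOp, smul_eq_mul]
  rw [hvε, mul_neg, ← intervalIntegral.integral_const_mul, neg_add_eq_sub,
    ← intervalIntegral.integral_sub hRg (hv.1.const_mul _)]
  refine intervalIntegral.integral_mono_on_of_le_Ioo hεs.le (hRg.sub (hv.1.const_mul _)) hRg.abs
    fun r hr => ?_
  have h0 := barrierR0_zero_nonneg hα1 (sub_pos.2 hεs).le
  have hle : barrierR0 α 0 (s - ε) ≤ barrierR0 α 0 (s - r) :=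
    barrierR0_antitoneOn hα0 hα1 (sub_pos.2 hr.2) (sub_pos.2 hεs) (by linarith [hr.1])
  rw [← sub_mul, abs_mul, abs_of_nonneg (h0.trans hle)]
  exact (mul_le_mul_of_nonneg_left (le_abs_self _) (sub_nonneg.2 hle)).trans
    (mul_le_mul_of_nonneg_right (sub_le_self _ h0) (abs_nonneg _))

theorem truncatedOp_zero_nonpos_of_eq_zero (hα0 : 0 < α) (hα1 : α < 1) (hεs : ε < s)
    (hv : HasTimeDeriv v g ε s) (hv0 : ∀ r ∈ Icc ε s, 0 ≤ v r) (hvs : v s = 0)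
    (hRg : IntervalIntegrable (fun r => barrierR0 α 0 (s - r) * g r) volume ε s) :
    truncatedOp α 0 v g ε s ≤ 0 := by
  have hlim : Tendsto (fun b => ∫ r in b..s, |barrierR0 α 0 (s - r) * g r|) (𝓝[<] s) (𝓝 0) := by
    have h := intervalIntegral.continuousOn_primitive_interval_left
      ((intervalIntegrable_iff' enorm_ne_top).1 hRg.abs) s right_mem_uIcc
    rw [ContinuousWithinAt, intervalIntegral.integral_same, uIcc_of_le hεs.le] at h
    refine h.mono_left ?_
    rw [← nhdsWithin_Ioo_eq_nhdsLT hεs]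
    exact nhdsWithin_mono _ Ioo_subset_Icc_self
  refine ge_of_tendsto hlim ?_
  filter_upwards [Ioo_mem_nhdsLT hεs] with b hb
  calc truncatedOp α 0 v g ε s ≤ truncatedOp α 0 v g b s :=
        truncatedOp_anti hα0 hα1 hb.1.le hb.2 hv (fun r hr => hv0 r ⟨hr.1, hr.2.trans hb.2.le⟩) hRg
    _ ≤ _ := truncatedOp_zero_le_integral_abs hα0.le hα1 hb.2 (hv.mono hb.1.le hb.2.le le_rfl) hvs
        (hRg.mono_set (uIcc_subset_uIcc_right (mem_uIcc_of_le hb.1.le hb.2.le)))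

theorem HasCaputoDerivAt.le_truncatedOp {w : ℝ} (hα0 : 0 < α) (hα1 : α < 1)
    (hv : HasCaputoDerivAt α v s w) (hv0 : ∀ r ∈ Icc 0 s, 0 ≤ v r) (hε : 0 < ε) (hεs : ε < s) :
    w + μ * v s ≤ truncatedOp α μ v (deriv v) ε s := by
  obtain ⟨g, hg, hlim⟩ := hv.exists_tendsto_truncatedOp
  obtain ⟨hvε, hgε⟩ := hg ε ⟨hε, hεs⟩
  rw [truncatedOp_deriv hvε hεs.le, truncatedOp_eq_add hεs.le hvε hgε, smul_eq_mul]
  refine add_le_add_left (le_of_tendsto hlim ?_) _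
  filter_upwards [Ioo_mem_nhdsGT hε] with η hη
  have hs : 0 < s := hε.trans hεs
  have hηs : η < s := hη.2.trans hεs
  obtain ⟨hvη, hgη⟩ := hg η ⟨hη.1, hηs⟩
  have hR : barrierR0 α 0 s ≤ barrierR0 α 0 (s - η) :=
    barrierR0_antitoneOn hα0.le hα1 (sub_pos.2 hηs) hs (sub_le_self _ hη.1.le)
  have hjump : 0 ≤ (barrierR0 α 0 (s - η) - barrierR0 α 0 s) * v η :=
    mul_nonneg (sub_nonneg.2 hR) (hv0 η ⟨hη.1.le, hηs.le⟩)
  have hinit : 0 ≤ barrierR0 α 0 s * v 0 :=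
    mul_nonneg (barrierR0_zero_nonneg hα1 hs.le) (hv0 0 ⟨le_rfl, hs.le⟩)
  have hanti := truncatedOp_anti hα0 hα1 hη.2.le hεs hvη
    (fun r hr => hv0 r ⟨hη.1.le.trans hr.1, hr.2.trans hεs.le⟩) hgη
  simp only [smul_eq_mul]
  linarith

end Truncation

theorem exists_ae_norm_le_of_memLp_top {X Y : Type*} [NormedAddCommGroup X] [MeasurableSpace Y]
    {ν : Measure Y} {f : Y → X} (hf : MemLp f ∞ ν) : ∃ C : NNReal, ∀ᵐ x ∂ν, ‖f x‖ ≤ C := by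
  obtain ⟨C, hC⟩ := eLpNormEssSup_lt_top_iff_isBoundedUnder.1
    (eLpNorm_exponent_top.symm.trans_lt hf.2)
  exact ⟨C, eventually_map.1 hC⟩

theorem lipschitzOnWith_norm {X Y : Type*} [PseudoEMetricSpace X] [SeminormedAddCommGroup Y]
    {v : X → Y} {K : NNReal} {S : Set X} (hv : LipschitzOnWith K v S) :
    LipschitzOnWith K (fun r => ‖v r‖) S := by
  simpa only [one_mul] using! lipschitzWith_one_norm.comp_lipschitzOnWith hv

section TimeRegular

variable {X : Type*} [NormedAddCommGroup X] [NormedSpace ℝ X] {v v' : ℝ → X} {a b α t T : ℝ}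

theorem MemW1Inf.sub (hv : MemW1Inf v a b) (hv' : MemW1Inf v' a b) :
    MemW1Inf (fun s => v s - v' s) a b := by
  obtain ⟨g, hg, hvg⟩ := hv
  obtain ⟨g', hg', hvg'⟩ := hv'
  exact ⟨fun s => g s - g' s, hg.sub hg', hvg.sub hvg'⟩

theorem TimeRegular.sub (hv : TimeRegular T v) (hv' : TimeRegular T v') :
    TimeRegular T fun s => v s - v' s := fun ε t hε hεt htT =>
  ⟨(hv ε t hε hεt htT).1.sub (hv' ε t hε hεt htT).1,
    (hv ε t hε hεt htT).2.sub (hv' ε t hε hεt htT).2⟩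

theorem MemW1Inf.exists_lipschitzOnWith (hv : MemW1Inf v a b) :
    ∃ K : NNReal, LipschitzOnWith K v (Icc a b) := by
  obtain ⟨g, hg, hvg⟩ := hv
  obtain ⟨C, hC⟩ := exists_ae_norm_le_of_memLp_top hg
  rw [restrict_Ioo_eq_restrict_Ioc, ae_restrict_iff' measurableSet_Ioc] at hC
  have hint (z : ℝ) (hz : z ∈ Icc a b) : IntervalIntegrable g volume a z :=
    hvg.1.mono_set (uIcc_subset_uIcc_left (mem_uIcc_of_le hz.1 hz.2))
  refine ⟨C, LipschitzOnWith.of_dist_le_mul fun x hx y hy => ?_⟩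
  rw [dist_eq_norm, hvg.2 x hx, hvg.2 y hy, add_sub_add_left_eq_sub,
    intervalIntegral.integral_interval_sub_left (hint x hx) (hint y hy), Real.dist_eq]
  refine intervalIntegral.norm_integral_le_of_norm_le_const_ae ?_
  filter_upwards [hC] with r hr hrxy
  exact hr ⟨(le_min hy.1 hx.1).trans_lt hrxy.1, hrxy.2.trans (max_le hy.2 hx.2)⟩

theorem TimeRegular.continuousOn (hv : TimeRegular T v) : ContinuousOn v (Ioc 0 T) := by
  intro s hs
  have hsT : s / 2 < T := (half_lt_self hs.1).trans_le hs.2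
  obtain ⟨K, hK⟩ := (hv (s / 2) T (half_pos hs.1) hsT le_rfl).2.exists_lipschitzOnWith
  refine (hK.continuousOn s ⟨(half_lt_self hs.1).le, hs.2⟩).mono_of_mem_nhdsWithin ?_
  filter_upwards [self_mem_nhdsWithin,
    mem_nhdsWithin_of_mem_nhds (Ioi_mem_nhds (half_lt_self hs.1))]
    with r hr hsr using ⟨le_of_lt hsr, hr.2⟩

theorem TimeRegular.exists_norm_le (hT : 0 < T) (hv : TimeRegular T v) :
    ∃ C : ℝ, ∀ s ∈ Ioc 0 T, ‖v s‖ ≤ C := by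
  obtain ⟨C, hC⟩ :=
    exists_ae_norm_le_of_memLp_top (hv (T / 2) T (half_pos hT) (half_lt_self hT) le_rfl).1
  have hmax : (fun s => max ‖v s‖ C) =ᵐ[volume.restrict (Ioc 0 T)] fun _ => (C : ℝ) := by
    rw [← restrict_Ioo_eq_restrict_Ioc]
    exact hC.mono fun s hs => max_eq_right hs
  have heq := Measure.eqOn_Ioc_of_ae_eq volume hmax
    (ContinuousOn.sup hv.continuousOn.norm continuousOn_const) continuousOn_const
  exact ⟨C, fun s hs => max_eq_right_iff.1 (heq hs)⟩

theorem HasCaputoDerivAt.sub {w w' : X} (ht : 0 < t) (hv : HasCaputoDerivAt α v t w)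
    (hv' : HasCaputoDerivAt α v' t w') : HasCaputoDerivAt α (fun s => v s - v' s) t (w - w') := by
  obtain ⟨g, hg, hlim⟩ := hv
  obtain ⟨g', hg', hlim'⟩ := hv'
  refine ⟨fun s => g s - g' s, fun ε hε => ⟨(hg ε hε).1.sub (hg' ε hε).1, ?_⟩, ?_⟩
  · simp_rw [smul_sub]
    exact (hg ε hε).2.sub (hg' ε hε).2
  · refine (hlim.sub hlim').congr' ?_
    filter_upwards [Ioo_mem_nhdsGT ht] with ε hε
    simp_rw [smul_sub]
    rw [intervalIntegral.integral_sub (hg ε hε).2 (hg' ε hε).2]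
    module

theorem HasCaputoDerivAt.exists_tendsto_truncatedOp_of_norm_le {w : X} {C : ℝ} (ht : 0 < t)
    (hv : HasCaputoDerivAt α v t w) (hC : ∀ s ∈ Ioc 0 t, ‖v s‖ ≤ C) :
    ∃ g : ℝ → X,
      (∀ ε ∈ Ioo 0 t, HasTimeDeriv v g ε t ∧
        IntervalIntegrable (fun s => barrierR0 α 0 (t - s) • g s) volume ε t) ∧
      Tendsto (fun ε => truncatedOp α 0 v g ε t) (𝓝[>] 0) (𝓝 (w + barrierR0 α 0 t • v 0)) := by
  obtain ⟨g, hg, hlim⟩ := hv.exists_tendsto_truncatedOp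
  refine ⟨g, hg, ?_⟩
  have hR0 : Tendsto (fun ε => barrierR0 α 0 (t - ε) - barrierR0 α 0 t) (𝓝[>] 0) (𝓝 0) := by
    have hcont : ContinuousAt (fun ε => barrierR0 α 0 (t - ε) - barrierR0 α 0 t) 0 := by
      refine ContinuousAt.sub ?_ continuousAt_const
      exact (continuousAt_const.mul ((continuousAt_const.sub continuousAt_id).rpow_const
        (Or.inl (by simp [ht.ne'])))).add continuousAt_const
    simpa using hcont.tendsto.mono_left nhdsWithin_le_nhds
  have hjump : Tendsto (fun ε => (barrierR0 α 0 (t - ε) - barrierR0 α 0 t) • v ε) (𝓝[>] 0)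
      (𝓝 0) := by
    refine hR0.zero_smul_isBoundedUnder_le ⟨C, eventually_map.2 ?_⟩
    filter_upwards [Ioo_mem_nhdsGT ht] with ε hε using hC ε ⟨hε.1, hε.2.le⟩
  have hsum := (hlim.add hjump).add_const (barrierR0 α 0 t • v 0)
  rw [add_zero] at hsum
  exact hsum.congr fun ε => by abel

theorem map_truncatedOp [CompleteSpace X] {μ s : ℝ} {g : ℝ → X} (L : X →L[ℝ] ℝ)
    (hRg : IntervalIntegrable (fun r => barrierR0 α μ (s - r) • g r) volume a s) :
    L (truncatedOp α μ v g a s) = truncatedOp α μ (fun r => L (v r)) (fun r => L (g r)) a s := by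
  simp only [truncatedOp, map_add, map_smul, ← L.intervalIntegral_comp_comm hRg]

theorem truncatedOp_sub {μ s : ℝ} {g g' : ℝ → X}
    (hRg : IntervalIntegrable (fun r => barrierR0 α μ (s - r) • g r) volume a s)
    (hRg' : IntervalIntegrable (fun r => barrierR0 α μ (s - r) • g' r) volume a s) :
    truncatedOp α μ (fun r => v r - v' r) (fun r => g r - g' r) a s =
      truncatedOp α μ v g a s - truncatedOp α μ v' g' a s := by
  simp only [truncatedOp, smul_sub, intervalIntegral.integral_sub hRg hRg']
  abel

end TimeRegular

theorem intervalIntegrable_barrierR0_mul_deriv {v : ℝ → ℝ} {K : NNReal} {a s α μ : ℝ} (hα : α < 1)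
    (has : a ≤ s) (hv : LipschitzOnWith K v (Icc a s)) :
    IntervalIntegrable (fun r => barrierR0 α μ (s - r) * deriv v r) volume a s := by
  have hR : IntervalIntegrable (fun r => barrierR0 α μ (s - r)) volume a s :=
    ((intervalIntegrable_sub_rpow (by linarith)).const_mul _).add intervalIntegrable_const
  rw [intervalIntegrable_iff_integrableOn_Ioc_of_le has] at hR ⊢
  refine Integrable.mul_bdd (c := K) hR (measurable_deriv v).aestronglyMeasurable ?_
  filter_upwards [ae_restrict_Ioc_mem_Ioo] with r hr
  exact norm_deriv_le_of_lipschitzOn (Icc_mem_nhds hr.1 hr.2) hv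

section Hilbert

variable {H : Type*} [NormedAddCommGroup H] [InnerProductSpace ℝ H] [CompleteSpace H]
  {v : ℝ → H} {w : H} {α μ C T ρ ε s : ℝ}

theorem norm_mul_truncatedOp_norm_le_inner {g : ℝ → H} {g' : ℝ → ℝ} (hα0 : 0 < α) (hα1 : α < 1)
    (hεs : ε < s) (hv : HasTimeDeriv v g ε s)
    (hRg : IntervalIntegrable (fun r => barrierR0 α 0 (s - r) • g r) volume ε s)
    (hnv : HasTimeDeriv (fun r => ‖v r‖) g' ε s)
    (hRg' : IntervalIntegrable (fun r => barrierR0 α 0 (s - r) * g' r) volume ε s) :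
    ‖v s‖ * truncatedOp α 0 (fun r => ‖v r‖) g' ε s ≤ inner ℝ (v s) (truncatedOp α 0 v g ε s) := by
  let M : ℝ →L[ℝ] ℝ := ‖v s‖ • ContinuousLinearMap.id ℝ ℝ
  let L : H →L[ℝ] ℝ := innerSL ℝ (v s)
  have hRM : IntervalIntegrable (fun r => barrierR0 α 0 (s - r) • M (g' r)) volume ε s := by
    simp only [← M.map_smul]
    exact ⟨M.integrable_comp hRg'.1, M.integrable_comp hRg'.2⟩
  have hRL : IntervalIntegrable (fun r => barrierR0 α 0 (s - r) • L (g r)) volume ε s := by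
    simp only [← L.map_smul]
    exact ⟨L.integrable_comp hRg.1, L.integrable_comp hRg.2⟩
  have h := truncatedOp_zero_nonpos_of_eq_zero hα0 hα1 hεs ((hnv.clm_comp M).sub (hv.clm_comp L))
    (fun r _ => sub_nonneg.2 (real_inner_le_norm (v s) (v r))) (by simp [M, L, sq])
    ((hRM.sub hRL).congr fun r _ => by simp [mul_sub])
  rwa [truncatedOp_sub hRM hRL, ← map_truncatedOp M hRg', ← map_truncatedOp L hRg,
    sub_nonpos] at h

theorem norm_mul_truncatedOp_norm_sub_le_inner (hα0 : 0 < α) (hα1 : α < 1) (hv : TimeRegular T v)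
    (hC : ∀ r ∈ Ioc 0 T, ‖v r‖ ≤ C) (hε : 0 < ε) (hεs : ε < s) (hsT : s ≤ T)
    (hw : HasCaputoDerivAt α v s w) :
    ‖v s‖ * (truncatedOp α 0 (fun r => ‖v r‖) (deriv fun r => ‖v r‖) ε s -
      C * (barrierR0 α 0 (s - ε) - barrierR0 α 0 s)) ≤
      inner ℝ (v s) (w + barrierR0 α 0 s • v 0) := by
  have hs : 0 < s := hε.trans hεs
  have hC0 : 0 ≤ C := (norm_nonneg _).trans (hC s ⟨hs, hsT⟩)
  obtain ⟨g, hg, hlim⟩ := hw.exists_tendsto_truncatedOp_of_norm_le hs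
    fun r hr => hC r ⟨hr.1, hr.2.trans hsT⟩
  refine ge_of_tendsto (tendsto_const_nhds.inner hlim) ?_
  filter_upwards [Ioo_mem_nhdsGT hε] with η hη
  have hηs : η < s := hη.2.trans hεs
  obtain ⟨K, hK⟩ := (hv η s hη.1 hηs hsT).2.exists_lipschitzOnWith
  have hnK := lipschitzOnWith_norm hK
  obtain ⟨hgd, hgi⟩ := hg η ⟨hη.1, hηs⟩
  have hnd := hasTimeDeriv_deriv_of_lipschitzOnWith hnK hηs.le
  have hni := intervalIntegrable_barrierR0_mul_deriv (μ := 0) hα1 hηs.le hnK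
  refine le_trans (mul_le_mul_of_nonneg_left ?_ (norm_nonneg _))
    (norm_mul_truncatedOp_norm_le_inner hα0 hα1 hηs hgd hgi hnd hni)
  have hle := truncatedOp_le_add hα0 hα1 hη.2.le hεs hnd
    (fun r hr => hC r ⟨hη.1.trans_le hr.1, (hr.2.trans hεs.le).trans hsT⟩) hni
  have hR : barrierR0 α 0 s ≤ barrierR0 α 0 (s - η) :=
    barrierR0_antitoneOn hα0.le hα1 (sub_pos.2 hηs) hs (sub_le_self _ hη.1.le)
  have := mul_le_mul_of_nonneg_left hR hC0
  linarith

theorem truncatedOp_norm_le (hα0 : 0 < α) (hα1 : α < 1) (hv : TimeRegular T v)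
    (hC : ∀ r ∈ Ioc 0 T, ‖v r‖ ≤ C) (hε : 0 < ε) (hεs : ε < s) (hsT : s ≤ T) (hρ : 0 ≤ ρ)
    (hw : HasCaputoDerivAt α v s w)
    (henergy : inner ℝ (v s) (w + barrierR0 α 0 s • v 0) + μ * ‖v s‖ ^ 2 ≤ ρ * ‖v s‖) :
    truncatedOp α μ (fun r => ‖v r‖) (deriv fun r => ‖v r‖) ε s ≤
      ρ + C * (barrierR0 α μ (s - ε) - barrierR0 α μ s) := by
  have hs : 0 < s := hε.trans hεs
  obtain ⟨K, hK⟩ := (hv ε s hε hεs hsT).2.exists_lipschitzOnWith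
  have hnK := lipschitzOnWith_norm hK
  have hnd := hasTimeDeriv_deriv_of_lipschitzOnWith hnK hεs.le
  have hni := intervalIntegrable_barrierR0_mul_deriv (μ := 0) hα1 hεs.le hnK
  rw [truncatedOp_eq_add hεs.le hnd hni, barrierR0_eq_add (μ := μ) (x := s - ε),
    barrierR0_eq_add (μ := μ) (x := s), add_sub_add_right_eq_sub, smul_eq_mul]
  rcases (norm_nonneg (v s)).eq_or_lt with hvs | hvs
  · have hnonpos := truncatedOp_zero_nonpos_of_eq_zero hα0 hα1 hεs hnd (fun r _ => norm_nonneg _)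
      hvs.symm hni
    have hR : barrierR0 α 0 s ≤ barrierR0 α 0 (s - ε) :=
      barrierR0_antitoneOn hα0.le hα1 (sub_pos.2 hεs) hs (sub_le_self _ hε.le)
    have hC0 : 0 ≤ C := (norm_nonneg _).trans (hC s ⟨hs, hsT⟩)
    have := mul_nonneg hC0 (sub_nonneg.2 hR)
    rw [← hvs, mul_zero]
    linarith
  · have h := norm_mul_truncatedOp_norm_sub_le_inner hα0 hα1 hv hC hε hεs hsT hw
    refine le_of_mul_le_mul_left ?_ hvs
    linarith

end Hilbert

/-! ### Subsolutions -/

/-- `φ` is a subsolution of `(D_t^α + μ) φ = ρ` on `(0, T]`, in a form that needs no Caputo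
derivative of `φ`: the operator truncated at `ε` exceeds `ρ` at most by an error that
`(D_t^α + μ)⁻¹` maps to a quantity vanishing as `ε → 0`. -/
structure IsCaputoSubsolution (α μ T : ℝ) (ρ φ : ℝ → ℝ) : Prop where
  hasTimeDeriv : ∀ t ∈ Ioc 0 T, ∀ ε ∈ Ioo 0 t, HasTimeDeriv φ (deriv φ) ε t
  exists_truncatedOp_le : ∃ C : ℝ, ∀ s ∈ Ioc 0 T, ∀ ε ∈ Ioo 0 s,
    truncatedOp α μ φ (deriv φ) ε s ≤ ρ s + C * (barrierR0 α μ (s - ε) - barrierR0 α μ s)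

theorem isCaputoSubsolution_norm {H : Type*} [NormedAddCommGroup H] [InnerProductSpace ℝ H]
    [CompleteSpace H] {v : ℝ → H} {α μ T : ℝ} {ρ : ℝ → ℝ} (hα0 : 0 < α) (hα1 : α < 1) (hT : 0 < T)
    (hv : TimeRegular T v) (hρ : ∀ t ∈ Ioc 0 T, 0 ≤ ρ t)
    (henergy : ∀ t ∈ Ioc 0 T, ∃ w, HasCaputoDerivAt α v t w ∧
      inner ℝ (v t) (w + barrierR0 α 0 t • v 0) + μ * ‖v t‖ ^ 2 ≤ ρ t * ‖v t‖) :
    IsCaputoSubsolution α μ T ρ fun t => ‖v t‖ := by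
  obtain ⟨C, hC⟩ := hv.exists_norm_le hT
  refine ⟨fun t ht ε hε => ?_, C, fun s hs ε hε => ?_⟩
  · obtain ⟨K, hK⟩ := (hv ε t hε.1 hε.2 ht.2).2.exists_lipschitzOnWith
    exact hasTimeDeriv_deriv_of_lipschitzOnWith (lipschitzOnWith_norm hK) hε.2.le
  · obtain ⟨w, hw, hwe⟩ := henergy s hs
    exact truncatedOp_norm_le hα0 hα1 hv hC hε.1 hε.2 hs.2 (hρ s hs) hw hwe

theorem ofReal_integral_le_lintegral_ofReal {Y : Type*} [MeasurableSpace Y] {ν : Measure Y}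
    (f : Y → ℝ) : ENNReal.ofReal (∫ x, f x ∂ν) ≤ ∫⁻ x, ENNReal.ofReal (f x) ∂ν := by
  by_cases hf : Integrable f ν
  · rw [integral_eq_lintegral_pos_part_sub_lintegral_neg_part hf]
    exact (ENNReal.ofReal_le_ofReal (sub_le_self _ ENNReal.toReal_nonneg)).trans
      ENNReal.ofReal_toReal_le
  · simp [integral_undef hf]

theorem ofReal_intervalIntegral_le_setLIntegral {f : ℝ → ℝ} {a b : ℝ} (hab : a ≤ b) :
    ENNReal.ofReal (∫ s in a..b, f s) ≤ ∫⁻ s in Ioo a b, ENNReal.ofReal (f s) := by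
  rw [intervalIntegral.integral_of_le hab, ← restrict_Ioo_eq_restrict_Ioc]
  exact ofReal_integral_le_lintegral_ofReal f

namespace IsCaputoSubsolution

variable {α μ T t : ℝ} {ρ φ : ℝ → ℝ}

theorem ofReal_le_caputoInv (h : IsCaputoSubsolution α μ T ρ φ) (hα0 : 0 < α) (hα1 : α < 1)
    (ht : t ∈ Ioc 0 T) :
    ENNReal.ofReal (φ t) ≤ caputoInv α μ (fun s => ENNReal.ofReal (ρ s)) t := by
  obtain ⟨C, hC⟩ := h.exists_truncatedOp_le
  have hlim := (ENNReal.tendsto_ofReal ((tendsto_integral_fracKernel_mul_barrierR0_sub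
    (μ := μ) hα0 hα1 ht.1).const_mul C)).const_add (caputoInv α μ (fun s => ENNReal.ofReal (ρ s)) t)
  rw [mul_zero, ENNReal.ofReal_zero, add_zero] at hlim
  refine ge_of_tendsto hlim ?_
  filter_upwards [Ioo_mem_nhdsGT ht.1] with ε hε
  have hφ := h.hasTimeDeriv t ht ε hε
  have hop := intervalIntegrable_fracKernel_mul_truncatedOp (μ := μ) hα0 hα1 hε.2 hφ.1 (v := φ)
  have herr := (intervalIntegrable_fracKernel_mul_barrierR0_sub (μ := μ) hα0 hα1 hε.1.le
    hε.2).const_mul C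
  rw [← integral_fracKernel_mul_truncatedOp (μ := μ) hα0 hα1 hε.2 hφ,
    ← intervalIntegral.integral_const_mul,
    ← sub_add_cancel (∫ s in ε..t, _ * truncatedOp _ _ _ _ _ _) (∫ s in ε..t, C * _),
    ← intervalIntegral.integral_sub hop herr]
  refine ENNReal.ofReal_add_le.trans (add_le_add_left ?_ _)
  refine (ofReal_intervalIntegral_le_setLIntegral hε.2.le).trans (le_trans ?_
    (lintegral_mono_set (Ioo_subset_Ioo_left hε.1.le)))
  refine setLIntegral_mono' measurableSet_Ioo fun s hs => ?_
  have hK := (fracKernel_pos (c := -μ) hα0 hα1.le (sub_pos.2 hs.2)).le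
  have hle := hC s ⟨hε.1.trans hs.1, hs.2.le.trans ht.2⟩ ε ⟨hε.1, hs.1⟩
  have hmul := mul_le_mul_of_nonneg_left (sub_le_iff_le_add.2 hle) hK
  refine (ENNReal.ofReal_le_ofReal (le_trans (le_of_eq ?_) hmul)).trans_eq (ENNReal.ofReal_mul hK)
  ring

theorem le_of_hasCaputoDerivAt (h : IsCaputoSubsolution α μ T ρ φ) (hα0 : 0 < α) (hα1 : α < 1)
    (ht : t ∈ Ioc 0 T) {B DB : ℝ → ℝ} (hB0 : ∀ s ∈ Icc 0 t, 0 ≤ B s)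
    (hB : ∀ s ∈ Ioc 0 t, HasCaputoDerivAt α B s (DB s))
    (hρ : ∀ s ∈ Ioo 0 t, ρ s ≤ DB s + μ * B s) : φ t ≤ B t := by
  obtain ⟨C, hC⟩ := h.exists_truncatedOp_le
  have hlim := ((tendsto_integral_fracKernel_mul_barrierR0_sub
    (μ := μ) hα0 hα1 ht.1).const_mul C).const_add (B t)
  rw [mul_zero, add_zero] at hlim
  refine ge_of_tendsto hlim ?_
  filter_upwards [Ioo_mem_nhdsGT ht.1] with ε hε
  have hφ := h.hasTimeDeriv t ht ε hε
  obtain ⟨g, hg, -⟩ := hB t ⟨ht.1, le_rfl⟩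
  have hBg := (hg ε hε).1
  have hIφ := intervalIntegrable_fracKernel_mul_truncatedOp (μ := μ) hα0 hα1 hε.2 hφ.1 (v := φ)
  have hIB := intervalIntegrable_fracKernel_mul_truncatedOp (μ := μ) hα0 hα1 hε.2 hBg.1 (v := B)
  have herr := (intervalIntegrable_fracKernel_mul_barrierR0_sub (μ := μ) hα0 hα1 hε.1.le
    hε.2).const_mul C
  rw [← integral_fracKernel_mul_truncatedOp (μ := μ) hα0 hα1 hε.2 hφ,
    ← integral_fracKernel_mul_truncatedOp (μ := μ) hα0 hα1 hε.2 hBg,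
    ← intervalIntegral.integral_const_mul, ← intervalIntegral.integral_add hIB herr]
  refine intervalIntegral.integral_mono_on_of_le_Ioo hε.2.le hIφ (hIB.add herr) fun s hs => ?_
  have hs0 : 0 < s := hε.1.trans hs.1
  have hBs := (hB s ⟨hs0, hs.2.le⟩).le_truncatedOp (μ := μ) hα0 hα1
    (fun r hr => hB0 r ⟨hr.1, hr.2.trans hs.2.le⟩) hε.1 hs.1
  rw [truncatedOp_deriv (hBg.mono le_rfl hs.1.le hs.2.le) hs.1.le] at hBs
  have hle := (hC s ⟨hs0, hs.2.le.trans ht.2⟩ ε ⟨hε.1, hs.1⟩).trans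
    (add_le_add_left ((hρ s ⟨hs0, hs.2⟩).trans hBs) _)
  have := mul_le_mul_of_nonneg_left hle (fracKernel_pos (c := -μ) hα0 hα1.le (sub_pos.2 hs.2)).le
  linarith

end IsCaputoSubsolution

/-! ### The energy inequality for elliptic operators -/

section Elliptic

variable {d : ℕ} {Ω : Set (Space d)}

theorem memLp_euclidean_apply {ν : Measure (Space d)} {V : Space d → Space d} (hV : MemLp V 2 ν)
    (i : Fin d) : MemLp (fun x => V x i) 2 ν :=
  (EuclideanSpace.proj i : Space d →L[ℝ] ℝ).comp_memLp' hV

theorem integral_mul_eq_inner (v w : L2 Ω) {φ : Space d → ℝ} (hw : w =ᵐ[volume.restrict Ω] φ) :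
    ∫ x in Ω, v x * φ x = inner ℝ v w := by
  rw [L2.inner_def]
  refine integral_congr_ae ?_
  filter_upwards [hw] with x hx
  rw [← hx, RCLike.inner_apply, conj_trivial, mul_comm]

theorem IsTestFunction.sub {φ ψ : Space d → ℝ} (hφ : IsTestFunction Ω φ)
    (hψ : IsTestFunction Ω ψ) : IsTestFunction Ω (φ - ψ) :=
  ⟨hφ.1.sub hψ.1, hφ.2.1.sub hψ.2.1, (tsupport_sub φ ψ).trans (union_subset hφ.2.2 hψ.2.2)⟩

theorem IsTestFunction.gradient_sub {φ ψ : Space d → ℝ} (hφ : IsTestFunction Ω φ)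
    (hψ : IsTestFunction Ω ψ) : gradient (φ - ψ) = gradient φ - gradient ψ := by
  ext1 x
  have hφx : DifferentiableAt ℝ φ x := hφ.1.differentiable (by simp) x
  have hψx : DifferentiableAt ℝ ψ x := hψ.1.differentiable (by simp) x
  simp only [gradient, Pi.sub_apply, fderiv_sub hφx hψx, map_sub]

theorem sub_mem_H10Graph {p q : L2 Ω × L2Vec Ω} (hp : p ∈ H10Graph Ω) (hq : q ∈ H10Graph Ω) :
    p - q ∈ H10Graph Ω := by
  refine map_mem_closure₂ continuous_sub hp hq ?_
  rintro p ⟨φ, hφ, hpφ, hpφ'⟩ q ⟨ψ, hψ, hqψ, hqψ'⟩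
  refine ⟨φ - ψ, hφ.sub hψ, (Lp.coeFn_sub p.1 q.1).trans (hpφ.sub hqψ), ?_⟩
  rw [hφ.gradient_sub hψ]
  exact (Lp.coeFn_sub p.2 q.2).trans (hpφ'.sub hqψ')

namespace EllipticOperator

variable (L : EllipticOperator Ω)

/-- The part `∑ᵢ bᵢ ∂ᵢ v + c v` of `ℒ v`, which is tested with `w` in `⟨ℒ v, w⟩`. -/
def lowerPart (v : Space d → ℝ) (V : Space d → Space d) (x : Space d) : ℝ :=
  (∑ i, L.b x i * V x i) + L.c x * v x

/-- The field with components `∑ⱼ aᵢⱼ ∂ⱼ v + pᵢ v`, which is tested with `∇w` in `⟨ℒ v, w⟩`. -/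
def flux (v : Space d → ℝ) (V : Space d → Space d) (x : Space d) : Space d :=
  WithLp.toLp 2 fun i => (∑ j, L.a x i j * V x j) + L.p x i * v x

theorem memLp_lowerPart {v : Space d → ℝ} {V : Space d → Space d}
    (hv : MemLp v 2 (volume.restrict Ω)) (hV : MemLp V 2 (volume.restrict Ω)) :
    MemLp (L.lowerPart v V) 2 (volume.restrict Ω) :=
  (memLp_finsetSum _ fun i _ => (memLp_euclidean_apply hV i).mul (L.b_mem i)).add (hv.mul L.c_mem)

theorem memLp_flux {v : Space d → ℝ} {V : Space d → Space d}
    (hv : MemLp v 2 (volume.restrict Ω)) (hV : MemLp V 2 (volume.restrict Ω)) :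
    MemLp (L.flux v V) 2 (volume.restrict Ω) :=
  MemLp.of_eval_piLp fun i =>
    (memLp_finsetSum _ fun j _ => (memLp_euclidean_apply hV j).mul (L.a_mem i j)).add
      (hv.mul (L.p_mem i))

theorem pairing_eq_integral (v : Space d → ℝ) (V : Space d → Space d) (w : Space d → ℝ)
    (W : Space d → Space d) :
    L.pairing v V w W = ∫ x in Ω, inner ℝ (w x) (L.lowerPart v V x) +
      inner ℝ (W x) (L.flux v V x) := by
  refine integral_congr_ae (ae_of_all _ fun x => ?_)
  simp only [lowerPart, flux, PiLp.inner_apply, RCLike.inner_apply, conj_trivial, add_mul,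
    Finset.sum_mul, Finset.sum_add_distrib]
  ring

theorem pairing_eq_inner (v w : L2 Ω) (V W : L2Vec Ω) :
    L.pairing v V w W = inner ℝ w (L.memLp_lowerPart (Lp.memLp v) (Lp.memLp V)).toLp +
      inner ℝ W (L.memLp_flux (Lp.memLp v) (Lp.memLp V)).toLp := by
  rw [pairing_eq_integral, L2.inner_def, L2.inner_def,
    ← integral_add (L2.integrable_inner _ _) (L2.integrable_inner _ _)]
  refine integral_congr_ae ?_
  filter_upwards [(L.memLp_lowerPart (Lp.memLp v) (Lp.memLp V)).coeFn_toLp,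
    (L.memLp_flux (Lp.memLp v) (Lp.memLp V)).coeFn_toLp] with x hlower hflux
  rw [hlower, hflux]

theorem pairing_congr_right (v : Space d → ℝ) (V : Space d → Space d) {w w' : Space d → ℝ}
    {W W' : Space d → Space d} (hw : w =ᵐ[volume.restrict Ω] w')
    (hW : W =ᵐ[volume.restrict Ω] W') : L.pairing v V w W = L.pairing v V w' W' := by
  refine integral_congr_ae ?_
  filter_upwards [hw, hW] with x hx hx'
  rw [hx, hx']

theorem continuous_pairing (v : L2 Ω) (V : L2Vec Ω) :
    Continuous fun p : L2 Ω × L2Vec Ω => L.pairing v V p.1 p.2 := by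
  simp only [pairing_eq_inner]
  fun_prop

theorem toLp_lowerPart_sub (v v' : L2 Ω) (V V' : L2Vec Ω) :
    (L.memLp_lowerPart (Lp.memLp (v - v')) (Lp.memLp (V - V'))).toLp =
      (L.memLp_lowerPart (Lp.memLp v) (Lp.memLp V)).toLp -
        (L.memLp_lowerPart (Lp.memLp v') (Lp.memLp V')).toLp := by
  rw [← MemLp.toLp_sub]
  refine MemLp.toLp_congr _ _ ?_
  filter_upwards [Lp.coeFn_sub v v', Lp.coeFn_sub V V'] with x hv hV
  simp only [lowerPart, Pi.sub_apply, hv, hV, PiLp.sub_apply, mul_sub, Finset.sum_sub_distrib]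
  ring

theorem toLp_flux_sub (v v' : L2 Ω) (V V' : L2Vec Ω) :
    (L.memLp_flux (Lp.memLp (v - v')) (Lp.memLp (V - V'))).toLp =
      (L.memLp_flux (Lp.memLp v) (Lp.memLp V)).toLp -
        (L.memLp_flux (Lp.memLp v') (Lp.memLp V')).toLp := by
  rw [← MemLp.toLp_sub]
  refine MemLp.toLp_congr _ _ ?_
  filter_upwards [Lp.coeFn_sub v v', Lp.coeFn_sub V V'] with x hv hV
  ext i
  simp only [flux, Pi.sub_apply, hv, hV, PiLp.sub_apply, mul_sub, Finset.sum_sub_distrib]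
  ring

theorem pairing_sub_left (v v' w : L2 Ω) (V V' W : L2Vec Ω) :
    L.pairing (v - v' : L2 Ω) (V - V' : L2Vec Ω) w W =
      L.pairing v V w W - L.pairing v' V' w W := by
  simp only [pairing_eq_inner, toLp_lowerPart_sub, toLp_flux_sub, inner_sub_right]
  ring

variable {L}

theorem inner_add_pairing_eq_of_isTestFunction {v D R : L2 Ω} {V : L2Vec Ω}
    (h : ∀ (w : L2 Ω) (W : L2Vec Ω) (φ : Space d → ℝ), IsTestFunction Ω φ →
      w =ᵐ[volume.restrict Ω] φ → W =ᵐ[volume.restrict Ω] gradient φ →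
      inner ℝ D w + L.pairing v V w W = inner ℝ R w)
    {w : L2 Ω} {W : L2Vec Ω} (hw : (w, W) ∈ H10Graph Ω) :
    inner ℝ D w + L.pairing v V w W = inner ℝ R w := by
  have hclosed : IsClosed {p : L2 Ω × L2Vec Ω |
      inner ℝ D p.1 + L.pairing v V p.1 p.2 = inner ℝ R p.1} :=
    isClosed_eq ((by fun_prop : Continuous fun p : L2 Ω × L2Vec Ω => inner ℝ D p.1).add
      (L.continuous_pairing v V)) (by fun_prop)
  refine closure_minimal ?_ hclosed hw
  rintro p ⟨φ, hφ, hp, hp'⟩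
  exact h p.1 p.2 φ hφ hp hp'

theorem LowerBound.inner_add_le {μ : ℝ} (hL : L.LowerBound μ) {v D R : L2 Ω} {V : L2Vec Ω}
    (hv : (v, V) ∈ H10Graph Ω)
    (h : ∀ (w : L2 Ω) (W : L2Vec Ω) (φ : Space d → ℝ), IsTestFunction Ω φ →
      w =ᵐ[volume.restrict Ω] φ → W =ᵐ[volume.restrict Ω] gradient φ →
      inner ℝ D w + L.pairing v V w W = inner ℝ R w) :
    inner ℝ D v + μ * ‖v‖ ^ 2 ≤ inner ℝ R v :=
  (add_le_add_right (hL v V hv) _).trans_eq (inner_add_pairing_eq_of_isTestFunction h hv)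

end EllipticOperator

theorem IsModifiedResidual.exists_inner_add_le {L : EllipticOperator Ω} {α T μ t : ℝ}
    (hL : L.LowerBound μ) {f : ℝ → Space d → ℝ} {u₀ : L2 Ω} {u uh R : ℝ → L2 Ω}
    (hu : IsSolution Ω L α T f u₀ u) (hR : IsModifiedResidual Ω L α T f u₀ uh R)
    (ht : t ∈ Ioc 0 T) :
    ∃ w, HasCaputoDerivAt α (fun s => uh s - u s) t w ∧
      inner ℝ (w + ((Real.Gamma (1 - α))⁻¹ * t ^ (-α)) • (uh 0 - u 0)) (uh t - u t) +
        μ * ‖uh t - u t‖ ^ 2 ≤ inner ℝ (R t) (uh t - u t) := by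
  obtain ⟨hu0, hu⟩ := hu
  obtain ⟨U, Du, hU, hDu, hweak⟩ := hu t ht
  obtain ⟨Uh, Duh, hUh, hDuh, hweakh⟩ := hR t ht
  refine ⟨Duh - Du, hDuh.sub ht.1 hDu,
    hL.inner_add_le (sub_mem_H10Graph hUh hU) fun w W φ hφ hw hW => ?_⟩
  have hinit : ∫ x in Ω, (uh 0 x - u₀ x) * (Real.Gamma (1 - α))⁻¹ * t ^ (-α) * φ x =
      (Real.Gamma (1 - α))⁻¹ * t ^ (-α) * inner ℝ (uh 0 - u₀) w := by
    rw [← integral_mul_eq_inner _ w hw, ← integral_const_mul]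
    refine integral_congr_ae ?_
    filter_upwards [Lp.coeFn_sub (uh 0) u₀] with x hx
    rw [hx, Pi.sub_apply]
    ring
  have hu_test := hweak φ hφ
  rw [integral_mul_eq_inner _ w hw, ← L.pairing_congr_right _ _ hw hW] at hu_test
  have huh_test := hweakh φ hφ
  rw [integral_mul_eq_inner _ w hw, integral_mul_eq_inner _ w hw, hinit,
    ← L.pairing_congr_right _ _ hw hW] at huh_test
  rw [hu0, inner_add_left, inner_sub_left, real_inner_smul_left, L.pairing_sub_left]
  linarith

end Elliptic

/-! ### Explicit barriers -/

section Caputo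

variable {X : Type*} [NormedAddCommGroup X] [NormedSpace ℝ X] {v g : ℝ → X} {α t : ℝ}

theorem HasCaputoDerivAt.const_smul {w : X} (hv : HasCaputoDerivAt α v t w) (c : ℝ) :
    HasCaputoDerivAt α (fun s => c • v s) t (c • w) := by
  obtain ⟨g, hg, hlim⟩ := hv
  refine ⟨fun s => c • g s, fun ε hε => ⟨⟨(hg ε hε).1.1.smul c, fun s hs => ?_⟩, ?_⟩, ?_⟩
  · beta_reduce
    rw [(hg ε hε).1.2 s hs, intervalIntegral.integral_smul, smul_add]
  · exact ((hg ε hε).2.smul c).congr fun s _ => smul_comm _ _ _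
  · refine (hlim.const_smul c).congr fun ε => ?_
    simp only [smul_comm _ c, ← smul_sub, ← smul_add, intervalIntegral.integral_smul]

theorem hasCaputoDerivAt_ite_pos (ht : 0 < t) (hv : HasTimeDeriv v g 0 t)
    (hg : IntervalIntegrable (fun s => (t - s) ^ (-α) • g s) volume 0 t) :
    HasCaputoDerivAt α (fun s => if 0 < s then v s else 0) t
      ((Real.Gamma (1 - α))⁻¹ • (t ^ (-α) • v 0 + ∫ s in 0..t, (t - s) ^ (-α) • g s)) := by
  refine ⟨g, fun ε hε => ⟨?_, hg.mono_set ?_⟩, ?_⟩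
  · refine ⟨(hv.mono hε.1.le hε.2.le le_rfl).1, fun s hs => ?_⟩
    simp only [hε.1, hε.1.trans_le hs.1, if_true]
    exact (hv.mono hε.1.le hε.2.le le_rfl).2 s hs
  · rw [uIcc_of_le hε.2.le, uIcc_of_le ht.le]
    exact Icc_subset_Icc_left hε.1.le
  · have hnhds : 𝓝[>] (0 : ℝ) ≤ 𝓝[Icc 0 t] 0 := by
      rw [← nhdsWithin_Ioo_eq_nhdsGT ht]
      exact nhdsWithin_mono _ Ioo_subset_Icc_self
    have hlim_v : Tendsto v (𝓝[>] 0) (𝓝 (v 0)) :=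
      (hv.continuousOn ht.le 0 ⟨le_rfl, ht.le⟩).mono_left hnhds
    have hlim_int : Tendsto (fun ε => ∫ s in ε..t, (t - s) ^ (-α) • g s) (𝓝[>] 0)
        (𝓝 (∫ s in 0..t, (t - s) ^ (-α) • g s)) := by
      have hcont := intervalIntegral.continuousOn_primitive_interval_left
        ((intervalIntegrable_iff_integrableOn_Icc_of_le ht.le).1 hg |>.mono_set
          (uIcc_of_le ht.le).subset)
      rw [uIcc_of_le ht.le] at hcont
      exact (hcont 0 ⟨le_rfl, ht.le⟩).mono_left hnhds
    refine (((hlim_v.const_smul _).add hlim_int).const_smul _).congr' ?_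
    filter_upwards [self_mem_nhdsWithin] with ε hε
    rw [if_pos (mem_Ioi.1 hε), if_neg (lt_irrefl 0), sub_zero]

end Caputo

theorem hasCaputoDerivAt_step {α t : ℝ} (ht : 0 < t) :
    HasCaputoDerivAt α (fun s : ℝ => if 0 < s then (1 : ℝ) else 0) t
      ((Real.Gamma (1 - α))⁻¹ * t ^ (-α)) := by
  simpa using hasCaputoDerivAt_ite_pos (α := α) (v := fun _ => (1 : ℝ)) (g := fun _ => 0) ht
    ⟨by simp, by simp⟩ (by simp)

/-- The right derivative of `ℰ₁`. -/
noncomputable def barrierE1Deriv (α τ s : ℝ) : ℝ := if s < τ then 0 else (α - 1) * s ^ (α - 2)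

section BarrierE1

variable {α τ t : ℝ}

theorem norm_barrierE1Deriv_le {s : ℝ} (hα1 : α < 1) (hτ : 0 < τ) :
    ‖barrierE1Deriv α τ s‖ ≤ (1 - α) * τ ^ (α - 2) := by
  have hα : 0 < 1 - α := sub_pos.2 hα1
  rw [barrierE1Deriv]
  split_ifs with h
  · rw [norm_zero]
    positivity
  · push Not at h
    have hs : 0 < s := hτ.trans_le h
    rw [norm_mul, Real.norm_eq_abs, Real.norm_eq_abs, abs_of_neg (by linarith), neg_sub,
      abs_of_pos (by positivity)]
    exact mul_le_mul_of_nonneg_left (Real.rpow_le_rpow_of_nonpos hτ h (by linarith)) hα.le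

theorem intervalIntegrable_mul_barrierE1Deriv {a b : ℝ} {k : ℝ → ℝ} (hα1 : α < 1) (hτ : 0 < τ)
    (hk : IntervalIntegrable k volume a b) :
    IntervalIntegrable (fun s => k s * barrierE1Deriv α τ s) volume a b := by
  have hmeas : Measurable (barrierE1Deriv α τ) :=
    Measurable.ite measurableSet_Iio measurable_const (by fun_prop)
  have hbdd : ∀ᵐ s, ‖barrierE1Deriv α τ s‖ ≤ (1 - α) * τ ^ (α - 2) :=
    ae_of_all _ fun _ => norm_barrierE1Deriv_le hα1 hτ
  exact ⟨hk.1.mul_bdd hmeas.aestronglyMeasurable (ae_restrict_of_ae hbdd),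
    hk.2.mul_bdd hmeas.aestronglyMeasurable (ae_restrict_of_ae hbdd)⟩

theorem hasDerivWithinAt_barrierE1 {s : ℝ} (hτ : 0 < τ) :
    HasDerivWithinAt (barrierE1 α τ) (barrierE1Deriv α τ s) (Ioi s) s := by
  rw [barrierE1Deriv]
  split_ifs with h
  · refine ((hasDerivAt_const s (τ ^ (α - 1))).congr_of_eventuallyEq ?_).hasDerivWithinAt
    filter_upwards [Iio_mem_nhds h] with r hr
    rw [barrierE1, max_eq_left (le_of_lt hr)]
  · push Not at h
    have hd := (Real.hasDerivAt_rpow_const (p := α - 1)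
      (Or.inl (hτ.trans_le h).ne')).hasDerivWithinAt (s := Ioi s)
    rw [show α - 1 - 1 = α - 2 by ring] at hd
    refine hd.congr (fun r hr => ?_) ?_
    · rw [barrierE1, max_eq_right (h.trans (le_of_lt hr))]
    · rw [barrierE1, max_eq_right h]

theorem hasTimeDeriv_barrierE1 {a b : ℝ} (hα1 : α < 1) (hτ : 0 < τ) :
    HasTimeDeriv (barrierE1 α τ) (barrierE1Deriv α τ) a b := by
  have hint : ∀ x y : ℝ, IntervalIntegrable (barrierE1Deriv α τ) volume x y := fun x y => by
    simpa using intervalIntegrable_mul_barrierE1Deriv (a := x) (b := y) (k := fun _ => 1) hα1 hτ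
      (by simp)
  have hcont : Continuous (barrierE1 α τ) :=
    (continuous_const.max continuous_id).rpow_const fun s =>
      Or.inl (hτ.trans_le (le_max_left τ s)).ne'
  refine ⟨hint a b, fun s _ => ?_⟩
  rw [intervalIntegral.integral_eq_sub_of_hasDeriv_right hcont.continuousOn
    (fun _ _ => hasDerivWithinAt_barrierE1 hτ) (hint a s), add_sub_cancel]

theorem hasDerivAt_sub_rpow_mul_rpow {s : ℝ} (hs : 0 < s) (hst : s < t) :
    HasDerivAt (fun s => t⁻¹ * ((t - s) ^ (1 - α) * s ^ (α - 1)))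
      ((t - s) ^ (-α) * ((α - 1) * s ^ (α - 2))) s := by
  have hts : 0 < t - s := sub_pos.2 hst
  have hleft := ((hasDerivAt_id s).const_sub t).rpow_const (p := 1 - α) (Or.inl hts.ne')
  have hright := Real.hasDerivAt_rpow_const (p := α - 1) (Or.inl hs.ne')
  refine ((hleft.mul hright).const_mul t⁻¹).congr_deriv ?_
  have hpow_left : (t - s) ^ (1 - α) = (t - s) ^ (-α) * (t - s) := by
    rw [← Real.rpow_add_one hts.ne']
    ring_nf
  have hpow_right : s ^ (α - 1) = s ^ (α - 2) * s := by
    rw [← Real.rpow_add_one hs.ne']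
    ring_nf
  have ht : t ≠ 0 := (hs.trans hst).ne'
  simp only [id]
  rw [show 1 - α - 1 = -α by ring, show α - 1 - 1 = α - 2 by ring, hpow_left, hpow_right]
  field_simp
  ring

theorem integral_sub_rpow_mul_barrierE1Deriv_of_le (hα1 : α < 1) (hτ : 0 < τ) (hτt : τ ≤ t) :
    ∫ s in τ..t, (t - s) ^ (-α) * barrierE1Deriv α τ s =
      -(t⁻¹ * ((t - τ) ^ (1 - α) * τ ^ (α - 1))) := by
  have hcont : ContinuousOn (fun s : ℝ => t⁻¹ * ((t - s) ^ (1 - α) * s ^ (α - 1))) (Icc τ t) :=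
    continuousOn_const.mul <| ContinuousOn.mul
      ((continuousOn_const.sub continuousOn_id).rpow_const fun s _ => Or.inr (by linarith))
      (continuousOn_id.rpow_const fun s hs => Or.inl (hτ.trans_le hs.1).ne')
  rw [intervalIntegral.integral_eq_sub_of_hasDerivAt_of_le hτt hcont (fun s hs => ?_)
    (intervalIntegrable_mul_barrierE1Deriv hα1 hτ (intervalIntegrable_sub_rpow (by linarith))),
    sub_self, Real.zero_rpow (by linarith), zero_mul, mul_zero, zero_sub]
  rw [barrierE1Deriv, if_neg hs.1.not_gt]
  exact hasDerivAt_sub_rpow_mul_rpow (hτ.trans hs.1) hs.2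

theorem integral_sub_rpow_mul_barrierE1Deriv_eq_zero {x : ℝ} (hx : 0 ≤ x) (hxτ : x ≤ τ) :
    ∫ s in 0..x, (t - s) ^ (-α) * barrierE1Deriv α τ s = 0 := by
  rw [intervalIntegral.integral_congr_Ioo_of_le (g := fun _ => 0) hx fun s hs => ?_,
    intervalIntegral.integral_zero]
  simp only [barrierE1Deriv, if_pos (hs.2.trans_le hxτ), mul_zero]

theorem integral_sub_rpow_mul_barrierE1Deriv (hα1 : α < 1) (hτ : 0 < τ) (ht : 0 < t) :
    ∫ s in 0..t, (t - s) ^ (-α) * barrierE1Deriv α τ s =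
      -(t⁻¹ * (max 0 (t - τ) ^ (1 - α) * τ ^ (α - 1))) := by
  rcases le_total t τ with h | h
  · rw [integral_sub_rpow_mul_barrierE1Deriv_eq_zero ht.le h, max_eq_left (sub_nonpos.2 h),
      Real.zero_rpow (by linarith), zero_mul, mul_zero, neg_zero]
  · have hint : IntervalIntegrable (fun s => (t - s) ^ (-α) * barrierE1Deriv α τ s) volume 0 t :=
      intervalIntegrable_mul_barrierE1Deriv hα1 hτ (intervalIntegrable_sub_rpow (by linarith))
    have hτ_mem : τ ∈ uIcc 0 t := by rw [uIcc_of_le ht.le]; exact ⟨hτ.le, h⟩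
    rw [← intervalIntegral.integral_add_adjacent_intervals
      (hint.mono_set (uIcc_subset_uIcc_left hτ_mem))
      (hint.mono_set (uIcc_subset_uIcc_right hτ_mem)),
      integral_sub_rpow_mul_barrierE1Deriv_eq_zero hτ.le le_rfl, zero_add,
      integral_sub_rpow_mul_barrierE1Deriv_of_le hα1 hτ h, max_eq_right (sub_nonneg.2 h)]

theorem inv_mul_barrierRho_div (hτ : 0 < τ) (ht : 0 < t) :
    t⁻¹ * barrierRho α (τ / t) =
      t ^ (-α) * τ ^ (α - 1) - t⁻¹ * (max 0 (t - τ) ^ (1 - α) * τ ^ (α - 1)) := by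
  have hpow : t ^ (-α) = t⁻¹ * t ^ (1 - α) := by
    rw [← Real.rpow_neg_one, ← Real.rpow_add ht]
    ring_nf
  have hmax : max 0 (1 - τ / t) = max 0 (t - τ) / t := by
    rw [← max_div_div_right ht.le, zero_div, sub_div, div_self ht.ne']
  have hdiv : (τ / t) ^ (-(1 - α)) = τ ^ (α - 1) * t ^ (1 - α) := by
    rw [neg_sub, Real.div_rpow hτ.le ht.le, div_eq_mul_inv, ← Real.rpow_neg ht.le, neg_sub]
  have htpow := (Real.rpow_pos_of_pos ht (1 - α)).ne'
  rw [barrierRho, hmax, hdiv, hpow, Real.div_rpow (le_max_left _ _) ht.le]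
  field_simp

theorem hasCaputoDerivAt_barrierE1 (hα1 : α < 1) (hτ : 0 < τ) (ht : 0 < t) :
    HasCaputoDerivAt α (fun s : ℝ => if 0 < s then barrierE1 α τ s else 0) t
      ((Real.Gamma (1 - α))⁻¹ * t⁻¹ * barrierRho α (τ / t)) := by
  have h := hasCaputoDerivAt_ite_pos (α := α) ht (hasTimeDeriv_barrierE1 hα1 hτ)
    (intervalIntegrable_mul_barrierE1Deriv hα1 hτ (intervalIntegrable_sub_rpow (by linarith)))
  simp only [smul_eq_mul] at h
  rwa [integral_sub_rpow_mul_barrierE1Deriv hα1 hτ ht, barrierE1, max_eq_left hτ.le,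
    ← sub_eq_add_neg, ← inv_mul_barrierRho_div hτ ht, ← mul_assoc] at h

theorem rpow_mul_min_le_barrierRho {s : ℝ} (hα0 : 0 ≤ α) (hα1 : α < 1) (hs : 0 ≤ s) :
    s ^ (-(1 - α)) * min ((1 - α) * s) 1 ≤ barrierRho α s := by
  refine mul_le_mul_of_nonneg_left ?_ (Real.rpow_nonneg hs _)
  rcases le_or_gt 1 s with h | h
  · rw [max_eq_left (by linarith), Real.zero_rpow (by linarith), sub_zero]
    exact min_le_right _ _
  · have hbernoulli : (1 - s) ^ (1 - α) ≤ 1 - (1 - α) * s := by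
      simpa [← sub_eq_add_neg] using rpow_one_add_le_one_add_mul_self (s := -s) (p := 1 - α)
        (by linarith) (by linarith) (by linarith)
    rw [max_eq_right (by linarith)]
    exact (min_le_left _ _).trans (by linarith)

theorem barrierE1_pos (hτ : 0 < τ) : 0 < barrierE1 α τ t :=
  Real.rpow_pos_of_pos (lt_max_of_lt_left hτ) _

theorem barrierE1_le (hα1 : α ≤ 1) (ht : 0 < t) : barrierE1 α τ t ≤ t ^ (α - 1) :=
  Real.rpow_le_rpow_of_nonpos ht (le_max_right _ _) (by linarith)

theorem barrierR0_pos {μ : ℝ} (hα1 : α < 1) (hμ : 0 ≤ μ) (ht : 0 < t) : 0 < barrierR0 α μ t := by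
  have := Real.Gamma_pos_of_pos (sub_pos.2 hα1)
  rw [barrierR0]
  positivity

theorem barrierR1_pos {μ : ℝ} (hα0 : 0 ≤ α) (hα1 : α < 1) (hμ : 0 ≤ μ) (hτ : 0 < τ) (ht : 0 < t) :
    0 < barrierR1 α μ τ t := by
  have hρ : 0 < barrierRho α (τ / t) := by
    have : 0 < 1 - α := sub_pos.2 hα1
    have : 0 < min ((1 - α) * (τ / t)) 1 := lt_min (by positivity) one_pos
    exact lt_of_lt_of_le (by positivity)
      (rpow_mul_min_le_barrierRho hα0 hα1 (div_pos hτ ht).le)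
  have := Real.Gamma_pos_of_pos (sub_pos.2 hα1)
  have := barrierE1_pos (α := α) (t := t) hτ
  rw [barrierR1]
  positivity

end BarrierE1

namespace IsCaputoSubsolution

variable {α μ T t : ℝ} {ρ φ : ℝ → ℝ}

theorem ofReal_le_mul_iSup (h : IsCaputoSubsolution α μ T ρ φ) (hα0 : 0 < α) (hα1 : α < 1)
    (ht : t ∈ Ioc 0 T) {B DB b : ℝ → ℝ} (hB0 : ∀ s ∈ Icc 0 t, 0 ≤ B s) (hBt : 0 < B t)
    (hB : ∀ s ∈ Ioc 0 t, HasCaputoDerivAt α B s (DB s)) (hb : ∀ s ∈ Ioc 0 t, 0 < b s)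
    (hbB : ∀ s ∈ Ioc 0 t, b s ≤ DB s + μ * B s) :
    ENNReal.ofReal (φ t) ≤
      ENNReal.ofReal (B t) * ⨆ s ∈ Ioc 0 t, ENNReal.ofReal (ρ s / b s) := by
  set M := ⨆ s ∈ Ioc 0 t, ENNReal.ofReal (ρ s / b s)
  by_cases htop : M = ⊤
  · rw [htop, ENNReal.mul_top (by simpa using hBt)]
    exact le_top
  have hM : ∀ s ∈ Ioc 0 t, ρ s ≤ M.toReal * b s := fun s hs => by
    rw [← div_le_iff₀ (hb s hs), ← ENNReal.ofReal_le_iff_le_toReal htop]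
    exact le_iSup₂ (f := fun s _ => ENNReal.ofReal (ρ s / b s)) s hs
  rw [← ENNReal.ofReal_toReal htop, ← ENNReal.ofReal_mul hBt.le, mul_comm]
  refine ENNReal.ofReal_le_ofReal (h.le_of_hasCaputoDerivAt hα0 hα1 ht
    (fun s hs => mul_nonneg ENNReal.toReal_nonneg (hB0 s hs))
    (fun s hs => (hB s hs).const_smul M.toReal) fun s hs => ?_)
  calc ρ s ≤ M.toReal * b s := hM s ⟨hs.1, hs.2.le⟩
    _ ≤ M.toReal * (DB s + μ * B s) :=
      mul_le_mul_of_nonneg_left (hbB s ⟨hs.1, hs.2.le⟩) ENNReal.toReal_nonneg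
    _ = M.toReal * DB s + μ * (M.toReal * B s) := by ring

theorem ofReal_le_iSup_div_barrierR0 (h : IsCaputoSubsolution α μ T ρ φ) (hα0 : 0 < α)
    (hα1 : α < 1) (hμ : 0 ≤ μ) (ht : t ∈ Ioc 0 T) :
    ENNReal.ofReal (φ t) ≤ ⨆ s ∈ Ioc 0 t, ENNReal.ofReal (ρ s / barrierR0 α μ s) := by
  have hle := h.ofReal_le_mul_iSup hα0 hα1 ht (B := fun s => if 0 < s then 1 else 0)
    (b := barrierR0 α μ) (fun s _ => by positivity) (by simp [ht.1])
    (fun s hs => hasCaputoDerivAt_step hs.1) (fun s hs => barrierR0_pos hα1 hμ hs.1)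
    (fun s hs => by simp [barrierR0, hs.1])
  simpa [ht.1] using hle

theorem ofReal_le_barrierE1_mul_iSup (h : IsCaputoSubsolution α μ T ρ φ) (hα0 : 0 < α)
    (hα1 : α < 1) (hμ : 0 ≤ μ) {τ : ℝ} (hτ : 0 < τ) (ht : t ∈ Ioc 0 T) :
    ENNReal.ofReal (φ t) ≤ ENNReal.ofReal (barrierE1 α τ t) *
      ⨆ s ∈ Ioc 0 t, ENNReal.ofReal (ρ s / barrierR1 α μ τ s) := by
  have hle := h.ofReal_le_mul_iSup hα0 hα1 ht (b := barrierR1 α μ τ)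
    (B := fun s => if 0 < s then barrierE1 α τ s else 0)
    (fun s _ => by split_ifs; exacts [(barrierE1_pos hτ).le, le_rfl])
    (by simpa [ht.1] using barrierE1_pos hτ)
    (fun s hs => hasCaputoDerivAt_barrierE1 hα1 hτ hs.1)
    (fun s hs => barrierR1_pos hα0.le hα1 hμ hτ hs.1) (fun s hs => by simp [barrierR1, hs.1])
  simpa [ht.1] using hle

end IsCaputoSubsolution

/-! ### Error bounds -/

theorem le_of_forall_mem_Ioc_le {φ B : ℝ → ℝ} {T : ℝ} (hT : 0 < T)
    (hφ : ContinuousWithinAt φ (Ici 0) 0) (hB : ContinuousWithinAt B (Ici 0) 0)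
    (hle : ∀ t ∈ Ioc 0 T, φ t ≤ B t) : φ 0 ≤ B 0 := by
  have hIoi : 𝓝[>] (0 : ℝ) ≤ 𝓝[≥] 0 := nhdsWithin_mono _ Ioi_subset_Ici_self
  refine le_of_tendsto_of_tendsto (hφ.mono_left hIoi) (hB.mono_left hIoi) ?_
  filter_upwards [Ioc_mem_nhdsGT hT] using hle

end FracParabolic

open FracParabolic in
theorem corollary3_general {H : Type*} [NormedAddCommGroup H] [InnerProductSpace ℝ H]
    [CompleteSpace H] (α T μ : ℝ) (hα0 : 0 < α) (hα1 : α < 1) (hT : 0 < T) (u uh R : ℝ → H)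
    (hu_reg : TimeRegular T u) (huh_reg : TimeRegular T uh)
    (huh_cont : ContinuousWithinAt uh (Ici 0) 0)
    (henergy : ∀ t ∈ Ioc 0 T, ∃ w, HasCaputoDerivAt α (fun s => uh s - u s) t w ∧
      inner ℝ (w + ((Real.Gamma (1 - α))⁻¹ * t ^ (-α)) • (uh 0 - u 0)) (uh t - u t)
        + μ * ‖uh t - u t‖ ^ 2 ≤ inner ℝ (R t) (uh t - u t)) :
    (∀ t ∈ Ioc 0 T, ‖uh t - u t‖ₑ ≤ caputoInv α μ (fun s => ‖R s‖ₑ) t) ∧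
    (∀ B DB : ℝ → ℝ, (∀ t ∈ Icc 0 T, 0 ≤ B t) →
      (∀ t ∈ Ioc 0 T, HasCaputoDerivAt α B t (DB t)) →
      (∀ t ∈ Ioc 0 T, ‖R t‖ ≤ DB t + μ * B t) →
      (∀ t ∈ Ioc 0 T, ‖uh t - u t‖ ≤ B t) ∧
      (ContinuousWithinAt B (Ici 0) 0 → ContinuousWithinAt u (Ici 0) 0 →
        ‖uh 0 - u 0‖ ≤ B 0)) ∧
    (0 ≤ μ → ∀ τ : ℝ, 0 < τ →
      (∀ t ∈ Ioc 0 T,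
        ‖uh t - u t‖ₑ ≤ (⨆ s ∈ Ioc 0 t, ENNReal.ofReal (‖R s‖ / barrierR0 α μ s)) ∧
        ‖uh t - u t‖ₑ ≤ ENNReal.ofReal (t ^ (α - 1)) *
          (⨆ s ∈ Ioc 0 t, ENNReal.ofReal (‖R s‖ / barrierR1 α μ τ s)) ∧
        ‖uh t - u t‖ₑ ≤ ENNReal.ofReal (barrierE1 α τ t) *
          (⨆ s ∈ Ioc 0 t, ENNReal.ofReal (‖R s‖ / barrierR1 α μ τ s))) ∧
      (∀ s : ℝ, 0 < s →
        s ^ (-(1 - α)) * min ((1 - α) * s) 1 ≤ barrierRho α s)) := by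
  have hsub : IsCaputoSubsolution α μ T (fun t => ‖R t‖) fun t => ‖uh t - u t‖ := by
    refine isCaputoSubsolution_norm hα0 hα1 hT (huh_reg.sub hu_reg) (fun t _ => norm_nonneg _)
      fun t ht => ?_
    obtain ⟨w, hw, hle⟩ := henergy t ht
    refine ⟨w, hw, ?_⟩
    rw [real_inner_comm, barrierR0, add_zero]
    exact hle.trans (real_inner_le_norm _ _)
  refine ⟨fun t ht => ?_, fun B DB hB0 hB hRB => ?_, fun hμ τ hτ => ⟨fun t ht => ?_, fun s hs =>
    rpow_mul_min_le_barrierRho hα0.le hα1 hs.le⟩⟩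
  · simpa only [ofReal_norm] using hsub.ofReal_le_caputoInv hα0 hα1 ht
  · have hle : ∀ t ∈ Ioc 0 T, ‖uh t - u t‖ ≤ B t := fun t ht =>
      hsub.le_of_hasCaputoDerivAt hα0 hα1 ht (fun s hs => hB0 s ⟨hs.1, hs.2.trans ht.2⟩)
        (fun s hs => hB s ⟨hs.1, hs.2.trans ht.2⟩)
        (fun s hs => hRB s ⟨hs.1, hs.2.le.trans ht.2⟩)
    exact ⟨hle, fun hBc huc => le_of_forall_mem_Ioc_le hT (huh_cont.sub huc).norm hBc hle⟩
  · have hR0 := hsub.ofReal_le_iSup_div_barrierR0 hα0 hα1 hμ ht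
    have hR1 := hsub.ofReal_le_barrierE1_mul_iSup hα0 hα1 hμ hτ ht
    simp only [ofReal_norm] at hR0 hR1
    exact ⟨hR0, hR1.trans (by gcongr; exact barrierE1_le hα1.le ht.1), hR1⟩

open FracParabolic in
theorem corollary3 {d : ℕ} (Ω : Set (Space d)) (hΩ : IsOpen Ω)
    (L : EllipticOperator Ω) (α T μ : ℝ) (hα0 : 0 < α) (hα1 : α < 1) (hT : 0 < T)
    (hL : L.LowerBound μ)
    (f : ℝ → Space d → ℝ) (hf : ∀ t ∈ Ioc 0 T, LocallyIntegrableOn (f t) Ω)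
    (u₀ : L2 Ω) (u uh R : ℝ → L2 Ω)
    (hu_reg : TimeRegular T u) (huh_reg : TimeRegular T uh)
    (hu : IsSolution Ω L α T f u₀ u)
    (huh_cont : ContinuousOn uh (Icc 0 T))
    (hR : IsModifiedResidual Ω L α T f u₀ uh R) :
    -- the error bound through the inverse of the fractional operator
    (∀ t ∈ Ioc 0 T, ‖uh t - u t‖ₑ ≤ caputoInv α μ (fun s => ‖R s‖ₑ) t) ∧
    -- the error bound through a barrier function
    (∀ B DB : ℝ → ℝ, (∀ t ∈ Icc 0 T, 0 ≤ B t) →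
      (∀ t ∈ Ioc 0 T, HasCaputoDerivAt α B t (DB t)) →
      (∀ t ∈ Ioc 0 T, ‖R t‖ ≤ DB t + μ * B t) →
      (∀ t ∈ Ioc 0 T, ‖uh t - u t‖ ≤ B t) ∧
      (ContinuousWithinAt B (Ici 0) 0 → ContinuousWithinAt u (Ici 0) 0 →
        ‖uh 0 - u 0‖ ≤ B 0)) ∧
    -- the error bounds for the two explicit residual barriers
    (0 ≤ μ → ∀ τ : ℝ, 0 < τ →
      (∀ t ∈ Ioc 0 T,
        ‖uh t - u t‖ₑ ≤ (⨆ s ∈ Ioc 0 t, ENNReal.ofReal (‖R s‖ / barrierR0 α μ s)) ∧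
        ‖uh t - u t‖ₑ ≤ ENNReal.ofReal (t ^ (α - 1)) *
          (⨆ s ∈ Ioc 0 t, ENNReal.ofReal (‖R s‖ / barrierR1 α μ τ s)) ∧
        ‖uh t - u t‖ₑ ≤ ENNReal.ofReal (barrierE1 α τ t) *
          (⨆ s ∈ Ioc 0 t, ENNReal.ofReal (‖R s‖ / barrierR1 α μ τ s))) ∧
      (∀ s : ℝ, 0 < s →
        s ^ (-(1 - α)) * min ((1 - α) * s) 1 ≤ barrierRho α s)) :=
  corollary3_general α T μ hα0 hα1 hT u uh R hu_reg huh_reg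
    ((huh_cont 0 ⟨le_rfl, hT.le⟩).mono_of_mem_nhdsWithin (Icc_mem_nhdsGE hT))
    fun _ ht => hR.exists_inner_add_le hL hu ht
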